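/- Let $\Sigma,\Gamma,\Phi$ be finite sets, let $\mu$ be a probability distribution on $\Sigma\times\Gamma\times\Phi$, let $m\ge 1$ be an integer, and let $t:\mathrm{supp}(\mu)\to\mathbb{Z}_m=\mathbb{Z}/m\mathbb{Z}$. The pair $(\mu,t)$ is a 3-player XOR game $\mathcal{G}$; the value $\mathrm{val}(\mathcal{G}^{\otimes n})$ of its $n$-fold repetition is the maximum, over all $f:\Sigma^n\to\mathbb{Z}_m^n$, $g:\Gamma^n\to\mathbb{Z}_m^n$, $h:\Phi^n\to\mathbb{Z}_m^n$, of $$\Pr_{(x,y,z)\sim\mu^{\otimes n}}\bigl[f(x)_i+g(y)_i+h(z)_i=t(x_i,y_i,z_i)\text{ for all } i=1,\dots,n\bigr].$$ Assume that: 1. $\mu$ is pairwise-connected: the bipartite graph with parts $\Sigma$ and $\Gamma$ in which $x$ and $y$ are joined iff $(x,y,z)\in\mathrm{supp}(\mu)$ for some $z$ is connected, and likewise the analogous graphs for $(\Gamma,\Phi)$ and for $(\Sigma,\Phi)$. 2. With $\omega=e^{2\pi i/m}$, the function $T(x,y,z)=\omega^{t(x,y,z)}$ on $\mathrm{supp}(\mu)$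 is nonembeddable over the closed unit disk $\mathbb{D}\subset\mathbb{C}$: there are no functions $A:\Sigma\to\mathbb{D}$, $B:\Gamma\to\mathbb{D}$, $C:\Phi\to\mathbb{D}$ with $A(x)B(y)C(z)T(x,y,z)=1$ for all $(x,y,z)\in\mathrm{supp}(\mu)$. Then there is a constant $c>0$, depending only on the game $\mathcal{G}=(\mu,t)$, such that $\mathrm{val}(\mathcal{G}^{\otimes n})\le 2^{-cn}$ for all $n$. -/

import Mathlib

/-- The `n`-fold product distribution of `μ` on a finite set `Ω`: the `n` coordinates are
independent, each distributed as `μ`. -/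
noncomputable def PMF.prodPow {Ω : Type*} [Fintype Ω] (μ : PMF Ω) (n : ℕ) : PMF (Fin n → Ω) :=
  PMF.ofFintype (fun q => ∏ i, μ (q i)) (by
    have h : ∑ a, μ a = 1 := by rw [← tsum_fintype (L := .unconditional _)]; exact μ.tsum_coe
    rw [← Fintype.piFinset_univ, ← Finset.prod_univ_sum]
    simp [h])

/-- A three-player XOR game with question alphabets `X`, `Y`, `Z` and answers in the abelian
group `A`: a distribution on question triples and a target function on its support. -/
structure XORGame (X Y Z A : Type*) where
  dist : PMF (X × Y × Z)
  target : dist.support → A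

namespace XORGame

variable {X Y Z A : Type*}

/-- The event, in the `n`-fold repeated game, that the strategies `f, g, h` give accepted answers
`f(x)ᵢ + g(y)ᵢ + h(z)ᵢ = t(xᵢ, yᵢ, zᵢ)` in every coordinate `i`. A point `q` lists the `n`
question triples `(xᵢ, yᵢ, zᵢ)`. -/
def winEvent [Add A] (G : XORGame X Y Z A) (n : ℕ) (f : (Fin n → X) → Fin n → A)
    (g : (Fin n → Y) → Fin n → A) (h : (Fin n → Z) → Fin n → A) : Set (Fin n → X × Y × Z) :=
  {q | ∀ i, ∃ hq : q i ∈ G.dist.support,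
    f (fun j => (q j).1) i + g (fun j => (q j).2.1) i + h (fun j => (q j).2.2) i
      = G.target ⟨q i, hq⟩}

/-- The probability that the strategies `f, g, h` win the `n`-fold repeated game. -/
noncomputable def winProb [Add A] [Fintype X] [Fintype Y] [Fintype Z] (G : XORGame X Y Z A) (n : ℕ)
    (f : (Fin n → X) → Fin n → A) (g : (Fin n → Y) → Fin n → A) (h : (Fin n → Z) → Fin n → A) : ℝ :=
  ((G.dist.prodPow n).toOuterMeasure (G.winEvent n f g h)).toReal

/-- The value of the `n`-fold repeated game: the largest winning probability of a triple of
strategies (a supremum over a finite non-empty set when `A` is a finite group). -/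
noncomputable def repeatedValue [Add A] [Fintype X] [Fintype Y] [Fintype Z] (G : XORGame X Y Z A)
    (n : ℕ) : ℝ :=
  ⨆ s : ((Fin n → X) → Fin n → A) × ((Fin n → Y) → Fin n → A) × ((Fin n → Z) → Fin n → A),
    G.winProb n s.1 s.2.1 s.2.2

end XORGame

/-- The bipartite graph on the disjoint union of `U` and `V` whose edges are the pairs `(u, v)`
with `R u v`. -/
def relBipartiteGraph {U V : Type*} (R : U → V → Prop) : SimpleGraph (U ⊕ V) :=
  SimpleGraph.fromRel (fun a b => ∃ u v, a = Sum.inl u ∧ b = Sum.inr v ∧ R u v)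

/-- `μ` is pairwise-connected: for each two of the three coordinates, the bipartite graph on the
two alphabets, whose edges are the pairs that extend to a point of the support, is connected. -/
def PairwiseConnected {X Y Z : Type*} (μ : PMF (X × Y × Z)) : Prop :=
  (relBipartiteGraph (fun (x : X) (y : Y) => ∃ z, (x, y, z) ∈ μ.support)).Connected ∧
  (relBipartiteGraph (fun (y : Y) (z : Z) => ∃ x, (x, y, z) ∈ μ.support)).Connected ∧
  (relBipartiteGraph (fun (x : X) (z : Z) => ∃ y, (x, y, z) ∈ μ.support)).Connected

/-- `T : supp(μ) → ℂ` is nonembeddable over the closed unit disk `𝔻` of `ℂ`: there are no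
`A, B, C` with values in `𝔻` and `A(x) B(y) C(z) T(x, y, z) = 1` on all of `supp(μ)`. -/
def Nonembeddable {X Y Z : Type*} (μ : PMF (X × Y × Z)) (T : μ.support → ℂ) : Prop :=
  ¬ ∃ (A : X → ℂ) (B : Y → ℂ) (C : Z → ℂ),
    (∀ x, A x ∈ Metric.closedBall (0 : ℂ) 1) ∧ (∀ y, B y ∈ Metric.closedBall (0 : ℂ) 1) ∧
    (∀ z, C z ∈ Metric.closedBall (0 : ℂ) 1) ∧
    ∀ p : μ.support, A p.1.1 * B p.1.2.1 * C p.1.2.2 * T p = 1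

/-- The function `T = ω ^ t` on the support, where `ω = exp(2πi/m)` and `t` is the target
function of a game over `ℤ/m`. -/
noncomputable def XORGame.phase {X Y Z : Type*} {m : ℕ} (G : XORGame X Y Z (ZMod m)) :
    G.dist.support → ℂ :=
  fun p => Complex.exp (2 * Real.pi * Complex.I / m) ^ (G.target p).val

open Finset in
/-- The weighted sum, over the points of `Ω ^ N`, of the product of the phases and of the
functions `f i`. -/
noncomputable def corr {N Ω ι : Type*} [Fintype N] [DecidableEq N] [Fintype Ω] [Fintype ι]
    (p : Ω → ℝ) (τ : Ω → Circle) (f : ι → (N → Ω) → ℂ) : ℂ :=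
  ∑ q : N → Ω, ((∏ k, p (q k) : ℝ) : ℂ) * ((∏ k, (τ (q k) : ℂ)) * ∏ i, f i q)

/-- The functions `f i` are bounded by one, and `f i q` only depends on the classes of the
coordinates of `q` under `r i`. -/
def Admissible {N Ω ι : Type*} (r : ι → Setoid Ω) (f : ι → (N → Ω) → ℂ) : Prop :=
  (∀ i q, ‖f i q‖ ≤ 1) ∧ ∀ i q q', (∀ k, r i (q k) (q' k)) → f i q = f i q'

/-- Exponential decay at rate `ρ` of all correlations with admissible functions. -/
def DecayBound {Ω ι : Type*} [Fintype Ω] [Fintype ι] (r : ι → Setoid Ω) (τ : Ω → Circle)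
    (p : Ω → ℝ) (ρ : ℝ) : Prop :=
  ∀ (N : Type) [Fintype N] [DecidableEq N] (f : ι → (N → Ω) → ℂ), Admissible r f →
    ‖corr p τ f‖ ≤ ρ ^ Fintype.card N

/-- For some probability weights, the correlations of the phase `τ` with products of functions of
the blocks `r i` decay exponentially. -/
def Decays {Ω ι : Type*} [Fintype Ω] [Fintype ι] (r : ι → Setoid Ω) (τ : Ω → Circle) : Prop :=
  ∃ (p : Ω → ℝ) (ρ : ℝ), (∀ ω, 0 ≤ p ω) ∧ ∑ ω, p ω = 1 ∧ 0 ≤ ρ ∧ ρ < 1 ∧ DecayBound r τ p ρ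

theorem sum_prod_pushforward {N Ω Ω' : Type*} [Fintype N] [DecidableEq N] [Fintype Ω]
    [DecidableEq Ω] [Fintype Ω'] (h : Ω' → Ω) (p : Ω' → ℝ) (G : (N → Ω) → ℂ) :
    ∑ q : N → Ω, ((∏ k, ∑ ω', (if h ω' = q k then p ω' else 0) : ℝ) : ℂ) * G q =
      ∑ q' : N → Ω', ((∏ k, p (q' k) : ℝ) : ℂ) * G (fun k => h (q' k)) := by
  have key : ∀ (q : N → Ω), (∏ k, ∑ ω', (if h ω' = q k then p ω' else 0) : ℝ) =
      ∑ q' : N → Ω', if (fun k => h (q' k)) = q then ∏ k, p (q' k) else 0 := by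
    intro q
    rw [Fintype.prod_sum]
    refine Finset.sum_congr rfl fun q' _ => ?_
    split_ifs with hq
    · subst hq; simp
    · have : ∃ k, h (q' k) ≠ q k := by
        by_contra hcon
        push Not at hcon
        exact hq (funext hcon)
      obtain ⟨k, hk⟩ := this
      exact Finset.prod_eq_zero (Finset.mem_univ k) (by simp [hk])
  simp_rw [key]
  push_cast
  simp_rw [Finset.sum_mul]
  rw [Finset.sum_comm]
  refine Finset.sum_congr rfl fun q' _ => ?_
  rw [Finset.sum_eq_single (fun k => h (q' k))]
  · simp
  · intro b _ hb
    simp [Ne.symm hb]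
  · simp

theorem norm_corr_mixture_le {Ω ι N : Type*} [Fintype Ω] [Fintype ι] [Fintype N] [DecidableEq N]
    {τ : Ω → Circle} {p0 p1 : Ω → ℝ} {ρ ε : ℝ} (f : ι → (N → Ω) → ℂ) (hε : 0 ≤ ε)
    (h1 : ∀ ω, 0 ≤ p1 ω)
    (hb : ∀ (T : Finset N) (b : {k // k ∉ T} → Ω),
      ‖∑ a : {k // k ∈ T} → Ω, ((∏ k, p0 (a k) : ℝ) : ℂ) * ((∏ k, (τ (a k) : ℂ)) *
        ∏ i, f i ((Equiv.piEquivPiSubtypeProd (fun k => k ∈ T) (fun _ => Ω)).symm (a, b)))‖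
        ≤ ρ ^ T.card) :
    ‖corr (fun ω => ε * p0 ω + p1 ω) τ f‖ ≤ (ε * ρ + ∑ ω, p1 ω) ^ Fintype.card N := by
  have hexp : corr (fun ω => ε * p0 ω + p1 ω) τ f = ∑ T : Finset N, ∑ q : N → Ω,
      (((∏ k ∈ T, (ε * p0 (q k))) * ∏ k ∈ Tᶜ, p1 (q k) : ℝ) : ℂ) *
        ((∏ k, (τ (q k) : ℂ)) * ∏ i, f i q) := by
    unfold corr
    rw [Finset.sum_comm]
    refine Finset.sum_congr rfl fun q _ => ?_
    rw [Fintype.prod_add, Complex.ofReal_sum, Finset.sum_mul]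
  have hpow : (ε * ρ + ∑ ω, p1 ω) ^ Fintype.card N =
      ∑ T : Finset N, (ε * ρ) ^ T.card * (∑ ω, p1 ω) ^ (Tᶜ).card := by
    have := Fintype.prod_add (fun _ : N => ε * ρ) (fun _ => ∑ ω, p1 ω)
    simpa using this
  rw [hexp, hpow]
  refine (norm_sum_le _ _).trans (Finset.sum_le_sum fun T _ => ?_)
  set e := Equiv.piEquivPiSubtypeProd (fun k => k ∈ T) (fun _ : N => Ω) with he
  have hT : ∀ (a : {k // k ∈ T} → Ω) (k : {k // k ∈ T}) (b : {k // k ∉ T} → Ω),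
      e.symm (a, b) k = a k := by
    intro a k b; simp [he, Equiv.piEquivPiSubtypeProd]
  have hTc : ∀ (a : {k // k ∈ T} → Ω) (b : {k // k ∉ T} → Ω) (k : {k // k ∉ T}),
      e.symm (a, b) k = b k := by
    intro a b k; simp [he, Equiv.piEquivPiSubtypeProd, k.2]
  rw [← e.symm.sum_comp, Fintype.sum_prod_type_right]
  have hterm : ∀ (b : {k // k ∉ T} → Ω), ‖∑ a : {k // k ∈ T} → Ω,
      (((∏ k ∈ T, (ε * p0 (e.symm (a, b) k))) * ∏ k ∈ Tᶜ, p1 (e.symm (a, b) k) : ℝ) : ℂ) *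
        ((∏ k, (τ (e.symm (a, b) k) : ℂ)) * ∏ i, f i (e.symm (a, b)))‖ ≤
      (ε * ρ) ^ T.card * ∏ k, p1 (b k) := by
    intro b
    have : ∀ a : {k // k ∈ T} → Ω,
      (((∏ k ∈ T, (ε * p0 (e.symm (a, b) k))) * ∏ k ∈ Tᶜ, p1 (e.symm (a, b) k) : ℝ) : ℂ) *
        ((∏ k, (τ (e.symm (a, b) k) : ℂ)) * ∏ i, f i (e.symm (a, b))) =
      ((ε ^ T.card * ∏ k, p1 (b k) : ℝ) : ℂ) * (∏ k, (τ (b k) : ℂ)) *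
        (((∏ k, p0 (a k) : ℝ) : ℂ) * ((∏ k, (τ (a k) : ℂ)) * ∏ i, f i (e.symm (a, b)))) := by
      intro a
      have e1 : (∏ k ∈ T, (ε * p0 (e.symm (a, b) k))) = ε ^ T.card * ∏ k, p0 (a k) := by
        rw [Finset.prod_mul_distrib, Finset.prod_const]
        congr 1
        rw [← Finset.prod_coe_sort]
        exact Finset.prod_congr rfl fun k _ => by rw [hT]
      have e2 : (∏ k ∈ Tᶜ, p1 (e.symm (a, b) k)) = ∏ k, p1 (b k) := by
        rw [Finset.prod_subtype (p := fun k => k ∉ T) Tᶜ (by simp)]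
        exact Finset.prod_congr rfl fun k _ => by rw [hTc]
      have e3 : (∏ k, (τ (e.symm (a, b) k) : ℂ)) =
          (∏ k, (τ (a k) : ℂ)) * ∏ k, (τ (b k) : ℂ) := by
        rw [← Fintype.prod_subtype_mul_prod_subtype (fun k => k ∈ T)]
        congr 1
        · exact Finset.prod_congr (by ext; simp) fun k _ => by rw [hT]
        · exact Finset.prod_congr (by ext; simp) fun k _ => by rw [hTc]
      rw [e1, e2, e3]
      push_cast
      ring
    simp_rw [this]
    rw [← Finset.mul_sum, norm_mul, norm_mul, norm_prod, Complex.norm_real, Real.norm_of_nonneg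
      (mul_nonneg (pow_nonneg hε _) (Finset.prod_nonneg fun k _ => h1 _))]
    simp only [Circle.norm_coe, Finset.prod_const_one, mul_one]
    calc _ ≤ (ε ^ T.card * ∏ k, p1 (b k)) * ρ ^ T.card :=
          mul_le_mul_of_nonneg_left (hb T b)
            (mul_nonneg (pow_nonneg hε _) (Finset.prod_nonneg fun k _ => h1 _))
      _ = _ := by rw [mul_pow]; ring
  refine (norm_sum_le _ _).trans ((Finset.sum_le_sum fun b _ => hterm b).trans ?_)
  rw [← Finset.mul_sum]
  refine le_of_eq ?_
  congr 1
  have := Fintype.prod_sum (fun (_ : {k // k ∉ T}) ω => p1 ω)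
  rw [← this]
  simp [Finset.card_compl]

/-- Decay transfers along a map of configurations, to all weights that are positive on the image
of the map. -/
theorem Decays.decayBound_of_map {Ω Ω' ι ι' : Type*} [Fintype Ω] [Fintype ι] [Fintype Ω']
    [Fintype ι'] {r' : ι' → Setoid Ω'} {τ' : Ω' → Circle} (hD : Decays r' τ')
    {r : ι → Setoid Ω} {τ : Ω → Circle} (h : Ω' → Ω) (π : ι → ι')
    (hτ : ∀ ω', τ (h ω') = τ' ω')
    (hr : ∀ i ω₁ ω₂, r' (π i) ω₁ ω₂ → r i (h ω₁) (h ω₂))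
    (p : Ω → ℝ) (hp : ∀ ω, 0 ≤ p ω) (hpos : ∀ ω', 0 < p (h ω')) (hsum : ∑ ω, p ω = 1) :
    ∃ ρ, 0 ≤ ρ ∧ ρ < 1 ∧ DecayBound r τ p ρ := by
  classical
  obtain ⟨p', ρ, hp', hs', hρ0, hρ1, hb⟩ := hD
  set p0 : Ω → ℝ := fun ω => ∑ ω', (if h ω' = ω then p' ω' else 0) with hp0
  have hne : Nonempty Ω' := by
    by_contra hcon
    rw [not_nonempty_iff] at hcon
    simp at hs'
  obtain ⟨ε, hε, hεle⟩ : ∃ ε, 0 < ε ∧ ∀ ω', ε ≤ p (h ω') := by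
    obtain ⟨ω', hω'⟩ := Finite.exists_min (fun ω' => p (h ω'))
    exact ⟨_, hpos ω', hω'⟩
  have hp0nn : ∀ ω, 0 ≤ p0 ω := fun ω =>
    Finset.sum_nonneg fun ω' _ => by split_ifs <;> simp [hp']
  have hp0sum : ∑ ω, p0 ω = 1 := by
    simp only [hp0]
    rw [Finset.sum_comm, ← hs']
    exact Finset.sum_congr rfl fun ω' _ => by simp
  have hp0le : ∀ ω, p0 ω ≤ 1 := fun ω => by
    rw [← hp0sum]
    exact Finset.single_le_sum (fun ω _ => hp0nn ω) (Finset.mem_univ ω)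
  have hp1 : ∀ ω, 0 ≤ p ω - ε * p0 ω := by
    intro ω
    by_cases hω : ∃ ω', h ω' = ω
    · obtain ⟨ω', rfl⟩ := hω
      have := mul_le_of_le_one_right hε.le (hp0le (h ω'))
      linarith [hεle ω']
    · have : p0 ω = 0 := Finset.sum_eq_zero fun ω' _ => if_neg fun hh => hω ⟨ω', hh⟩
      rw [this]; simpa using hp ω
  have hε1 : ε ≤ 1 := by
    obtain ⟨ω'⟩ := hne
    refine (hεle ω').trans ?_
    rw [← hsum]
    exact Finset.single_le_sum (fun ω _ => hp ω) (Finset.mem_univ (h ω'))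
  refine ⟨ε * ρ + (1 - ε), by nlinarith, by nlinarith, ?_⟩
  intro N _ _ f hf
  have hpe : p = fun ω => ε * p0 ω + (p ω - ε * p0 ω) := by funext ω; ring
  have hmix := norm_corr_mixture_le (τ := τ) (p0 := p0) (p1 := fun ω => p ω - ε * p0 ω) (ρ := ρ) f
    hε.le hp1 ?_
  · rw [← hpe] at hmix
    refine hmix.trans (le_of_eq ?_)
    rw [Finset.sum_sub_distrib, hsum, ← Finset.mul_sum, hp0sum, mul_one]
  · intro T b
    rw [sum_prod_pushforward h p' (fun a => (∏ k, (τ (a k) : ℂ)) * ∏ i, f i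
      ((Equiv.piEquivPiSubtypeProd (fun k => k ∈ T) (fun _ => Ω)).symm (a, b)))]
    have := hb {k // k ∈ T} (fun i' q' => ∏ i ∈ Finset.univ.filter (fun i => π i = i'),
      f i ((Equiv.piEquivPiSubtypeProd (fun k => k ∈ T) (fun _ => Ω)).symm
        ((fun k => h (q' k)), b))) ?_
    · simp only [Fintype.card_coe] at this
      refine le_trans (le_of_eq ?_) this
      unfold corr
      congr 1
      refine Finset.sum_congr rfl fun q' _ => ?_
      have hfib := Finset.prod_fiberwise Finset.univ π (fun i => f i
        ((Equiv.piEquivPiSubtypeProd (fun k => k ∈ T) (fun _ => Ω)).symm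
          ((fun k => h (q' k)), b)))
      simp only [hτ]
      rw [← hfib]
    · refine ⟨fun i' q' => ?_, fun i' q q' hqq => ?_⟩
      · rw [norm_prod]
        exact Finset.prod_le_one (fun _ _ => norm_nonneg _) fun i _ => hf.1 _ _
      · refine Finset.prod_congr rfl fun i hi => hf.2 _ _ _ fun k => ?_
        rw [Finset.mem_filter] at hi
        by_cases hk : k ∈ T
        · simp only [Equiv.piEquivPiSubtypeProd, Equiv.coe_fn_symm_mk, hk, dif_pos]
          exact hr i _ _ (hi.2 ▸ hqq ⟨k, hk⟩)
        · simp only [Equiv.piEquivPiSubtypeProd, Equiv.coe_fn_symm_mk, hk]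
          exact (r i).refl _

theorem Decays.of_map {Ω Ω' ι ι' : Type*} [Fintype Ω] [Fintype ι] [Fintype Ω']
    [Fintype ι'] {r' : ι' → Setoid Ω'} {τ' : Ω' → Circle} (hD : Decays r' τ')
    {r : ι → Setoid Ω} {τ : Ω → Circle} (h : Ω' → Ω) (π : ι → ι')
    (hτ : ∀ ω', τ (h ω') = τ' ω')
    (hr : ∀ i ω₁ ω₂, r' (π i) ω₁ ω₂ → r i (h ω₁) (h ω₂)) : Decays r τ := by
  have hne : Nonempty Ω := by
    obtain ⟨p', -, -, hs', -⟩ := hD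
    by_contra hcon
    rw [not_nonempty_iff] at hcon
    have : IsEmpty Ω' := Function.isEmpty h
    simp at hs'
  have hc : (0 : ℝ) < Fintype.card Ω := by exact_mod_cast Fintype.card_pos
  obtain ⟨ρ, h0, h1, hb⟩ := hD.decayBound_of_map (r := r) (τ := τ) h π hτ hr
    (fun _ => 1 / (Fintype.card Ω : ℝ)) (fun _ => by positivity) (fun _ => by positivity)
    (by simp)
  exact ⟨_, ρ, fun _ => by positivity, by simp, h0, h1, hb⟩

/-- Two points with different phases give decay when there are no functions. -/
theorem decays_of_isEmpty {Ω ι : Type*} [Fintype Ω] [Fintype ι] [IsEmpty ι]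
    (r : ι → Setoid Ω) (τ : Ω → Circle) (ω₁ ω₂ : Ω) (hne : τ ω₁ ≠ τ ω₂) : Decays r τ := by
  refine Decays.of_map (Ω' := Bool) (ι' := ι) (r' := fun i => isEmptyElim i)
    (τ' := fun b => τ (if b then ω₁ else ω₂)) ?_ (fun b => if b then ω₁ else ω₂) id
    (fun _ => rfl) (fun i => isEmptyElim i)
  refine ⟨fun _ => 1 / 2, ‖(1 / 2 : ℝ) • (τ ω₁ : ℂ) + (1 / 2 : ℝ) • (τ ω₂ : ℂ)‖, fun _ => by norm_num,
    by norm_num, norm_nonneg _, ?_, ?_⟩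
  · exact norm_combo_lt_of_ne (Circle.norm_coe _).le (Circle.norm_coe _).le (fun hh => hne (Circle.ext hh)) (by norm_num)
      (by norm_num) (by norm_num)
  · intro N _ _ f _
    have : corr (fun _ => 1 / 2) (fun b : Bool => τ (if b then ω₁ else ω₂)) f =
        ((1 / 2 : ℝ) • (τ ω₁ : ℂ) + (1 / 2 : ℝ) • (τ ω₂ : ℂ)) ^ Fintype.card N := by
      have h2 := Fintype.prod_sum (fun (_ : N) (b : Bool) =>
        ((1 / 2 : ℝ) : ℂ) * (τ (if b then ω₁ else ω₂) : ℂ))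
      simp only [Fintype.sum_bool, Finset.prod_const, Finset.card_univ, if_true] at h2
      simp only [Complex.real_smul]
      simp only [Bool.false_eq_true, if_false] at h2
      rw [h2]
      unfold corr
      refine Finset.sum_congr rfl fun q _ => ?_
      simp [Finset.prod_mul_distrib]
    rw [this, norm_pow]

/-- The uniform distribution on pairs of `R`-equivalent points: a uniform point, then a uniform
point of its class. -/
noncomputable def pairWeight {Ω : Type*} [Fintype Ω] (R : Setoid Ω) (a b : Ω) : ℝ :=
  open Classical in
  if R a b then 1 / ((Fintype.card Ω : ℝ) * (Finset.univ.filter (fun c => R a c)).card) else 0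

section pairWeight

variable {Ω : Type*} [Fintype Ω] (R : Setoid Ω)

theorem pairWeight_nonneg (a b : Ω) : 0 ≤ pairWeight R a b := by
  unfold pairWeight; split_ifs <;> positivity

theorem pairWeight_pos {a b : Ω} (h : R a b) : 0 < pairWeight R a b := by
  classical
  unfold pairWeight
  rw [if_pos h]
  have : Nonempty Ω := ⟨a⟩
  have h1 : 0 < Fintype.card Ω := Fintype.card_pos
  have h2 : 0 < (Finset.univ.filter (fun c => R a c)).card :=
    Finset.card_pos.2 ⟨a, by simp⟩
  positivity

theorem pairWeight_of_not {a b : Ω} (h : ¬ R a b) : pairWeight R a b = 0 := if_neg h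

theorem pairWeight_congr_left {a b : Ω} (h : R a b) (c : Ω) :
    pairWeight R a c = pairWeight R b c := by
  classical
  have : ∀ c, R a c ↔ R b c := fun c => ⟨fun h' => R.trans (R.symm h) h', fun h' => R.trans h h'⟩
  unfold pairWeight
  simp only [this]

theorem sum_pairWeight (a : Ω) : ∑ b, pairWeight R a b = 1 / (Fintype.card Ω : ℝ) := by
  classical
  unfold pairWeight
  rw [← Finset.sum_filter, Finset.sum_const, nsmul_eq_mul]
  have h2 : 0 < (Finset.univ.filter (fun c => R a c)).card :=
    Finset.card_pos.2 ⟨a, by simp⟩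
  have : (0 : ℝ) < ((Finset.univ.filter (fun c => R a c)).card : ℝ) := by exact_mod_cast h2
  have : Nonempty Ω := ⟨a⟩
  have h1 : (0 : ℝ) < Fintype.card Ω := by exact_mod_cast Fintype.card_pos
  field_simp

theorem sum_pairWeight_mul (a b : Ω) :
    ∑ c, pairWeight R a c * pairWeight R b c = pairWeight R a b / Fintype.card Ω := by
  classical
  by_cases hab : R a b
  · have : ∀ c, pairWeight R a c * pairWeight R b c = pairWeight R a b * pairWeight R a c := by
      intro c
      rw [← pairWeight_congr_left R hab]
      by_cases hc : R a c
      · have : pairWeight R a c = pairWeight R a b := by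
          unfold pairWeight; rw [if_pos hc, if_pos hab]
        rw [this]
      · rw [pairWeight_of_not R hc]; ring
    simp_rw [this]
    rw [← Finset.mul_sum, sum_pairWeight]; ring
  · rw [pairWeight_of_not R hab, zero_div]
    refine Finset.sum_eq_zero fun c _ => ?_
    by_cases hc : R a c
    · rw [pairWeight_of_not R (a := b) fun h => hab (R.trans hc (R.symm h)), mul_zero]
    · rw [pairWeight_of_not R hc, zero_mul]

end pairWeight

theorem sq_norm_sum_mul_le {Ω N : Type*} [Fintype Ω] [Nonempty Ω] [Fintype N] [DecidableEq N]
    (R : Setoid Ω) (u v : (N → Ω) → ℂ) (hu : ∀ q, ‖u q‖ ≤ 1)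
    (huR : ∀ q q', (∀ k, R (q k) (q' k)) → u q = u q') :
    ‖∑ q : N → Ω, ((∏ _k : N, (1 / (Fintype.card Ω : ℝ)) : ℝ) : ℂ) * (v q * u q)‖ ^ 2 ≤
      ‖∑ x : (N → Ω) × (N → Ω), ((∏ k, pairWeight R (x.1 k) (x.2 k) : ℝ) : ℂ) *
        (v x.1 * (starRingEnd ℂ) (v x.2))‖ := by
  classical
  set K : (N → Ω) → (N → Ω) → ℝ := fun a b => ∏ k, pairWeight R (a k) (b k) with hK
  set n : ℝ := (Fintype.card Ω : ℝ) with hn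
  have hnpos : 0 < n := by rw [hn]; exact_mod_cast Fintype.card_pos
  have hKsum : ∀ a, ∑ b, K a b = ∏ _k : N, (1 / n) := by
    intro a
    simp only [hK]
    rw [← Fintype.prod_sum (fun k ω => pairWeight R (a k) ω)]
    simp only [sum_pairWeight]; rfl
  have hKmul : ∀ a b, ∑ c, K a c * K b c = K a b / n ^ Fintype.card N := by
    intro a b
    simp only [hK, ← Finset.prod_mul_distrib]
    rw [← Fintype.prod_sum (fun k ω => pairWeight R (a k) ω * pairWeight R (b k) ω)]
    simp only [sum_pairWeight_mul]
    rw [Finset.prod_div_distrib, Finset.prod_const, Finset.card_univ]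
  have hKu : ∀ a b, (K a b : ℂ) * u a = K a b * u b := by
    intro a b
    by_cases h : ∀ k, R (a k) (b k)
    · rw [huR a b h]
    · push Not at h
      obtain ⟨k, hk⟩ := h
      have : K a b = 0 := Finset.prod_eq_zero (Finset.mem_univ k) (pairWeight_of_not R hk)
      rw [this]; simp
  set X : (N → Ω) → ℂ := fun b => ∑ a, (K a b : ℂ) * v a with hX
  have h1 : ∑ q : N → Ω, ((∏ _k : N, (1 / n) : ℝ) : ℂ) * (v q * u q) = ∑ b, u b * X b := by
    simp only [hX, Finset.mul_sum]
    rw [Finset.sum_comm]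
    refine Finset.sum_congr rfl fun a _ => ?_
    rw [← hKsum a]
    push_cast
    rw [Finset.sum_mul]
    refine Finset.sum_congr rfl fun b _ => ?_
    linear_combination v a * hKu a b
  rw [h1]
  have h2 : ‖∑ b, u b * X b‖ ≤ ∑ b, ‖X b‖ := by
    refine (norm_sum_le _ _).trans (Finset.sum_le_sum fun b _ => ?_)
    rw [norm_mul]
    exact mul_le_of_le_one_left (norm_nonneg _) (hu b)
  have h3 : (∑ b, ‖X b‖) ^ 2 ≤ n ^ Fintype.card N * ∑ b, ‖X b‖ ^ 2 := by
    have := sq_sum_le_card_mul_sum_sq (s := (Finset.univ : Finset (N → Ω))) (f := fun b => ‖X b‖)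
    simpa [hn] using this
  have h4 : ((n ^ Fintype.card N * ∑ b, ‖X b‖ ^ 2 : ℝ) : ℂ) =
      ∑ x : (N → Ω) × (N → Ω), (K x.1 x.2 : ℂ) * (v x.1 * (starRingEnd ℂ) (v x.2)) := by
    push_cast
    have : ∀ b, ((‖X b‖ : ℂ)) ^ 2 = X b * (starRingEnd ℂ) (X b) := fun b => by
      rw [Complex.mul_conj, Complex.normSq_eq_norm_sq]; push_cast; rfl
    simp_rw [this, hX, map_sum, map_mul, Complex.conj_ofReal, Finset.sum_mul_sum]
    rw [Finset.sum_comm, Fintype.sum_prod_type, Finset.mul_sum]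
    refine Finset.sum_congr rfl fun a _ => ?_
    rw [Finset.sum_comm, Finset.mul_sum]
    refine Finset.sum_congr rfl fun b _ => ?_
    have h5 : (K a b : ℂ) = n ^ Fintype.card N * ∑ c, (K a c : ℂ) * K b c := by
      have := hKmul a b
      have h6 : K a b = n ^ Fintype.card N * ∑ c, K a c * K b c := by
        rw [this]; field_simp
      rw [h6]; push_cast; rfl
    rw [h5, mul_assoc, Finset.sum_mul]
    congr 1
    refine Finset.sum_congr rfl fun c _ => ?_
    ring
  have h5 : n ^ Fintype.card N * ∑ b, ‖X b‖ ^ 2 =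
      ‖∑ x : (N → Ω) × (N → Ω), (K x.1 x.2 : ℂ) * (v x.1 * (starRingEnd ℂ) (v x.2))‖ := by
    rw [← h4, Complex.norm_real, Real.norm_of_nonneg]
    positivity
  rw [← h5]
  exact (pow_le_pow_left₀ (norm_nonneg _) h2 2).trans h3

/-- The Cauchy-Schwarz step: the blocks in `J` disappear, at the price of passing to pairs of
points that agree in these blocks. -/
theorem decays_of_double {Ω Ω' ι κ : Type*} [Fintype Ω] [Fintype Ω'] [Fintype ι] [Fintype κ]
    {r' : κ → Setoid Ω'} {τ' : Ω' → Circle} (hD : Decays r' τ')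
    {r : ι → Setoid Ω} {τ : Ω → Circle} (J : ι → Prop) (h1 h2 : Ω' → Ω)
    (hJ : ∀ j, J j → ∀ ω', r j (h1 ω') (h2 ω'))
    (hτ : ∀ ω', τ' ω' = τ (h1 ω') * (τ (h2 ω'))⁻¹)
    (π1 π2 : ∀ i, ¬ J i → κ)
    (hr1 : ∀ i hi a b, r' (π1 i hi) a b → r i (h1 a) (h1 b))
    (hr2 : ∀ i hi a b, r' (π2 i hi) a b → r i (h2 a) (h2 b)) : Decays r τ := by
  classical
  have hne : Nonempty Ω := by
    obtain ⟨p', -, -, hs', -⟩ := hD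
    by_contra hcon
    rw [not_nonempty_iff] at hcon
    have : IsEmpty Ω' := Function.isEmpty h1
    simp at hs'
  have hcard : (0 : ℝ) < Fintype.card Ω := by exact_mod_cast Fintype.card_pos
  set R : Setoid Ω := ⟨fun a b => ∀ j, J j → r j a b, fun a j _ => (r j).refl a,
    fun h j hj => (r j).symm (h j hj), fun h h' j hj => (r j).trans (h j hj) (h' j hj)⟩ with hR
  have hRiff : ∀ a b, R a b ↔ ∀ j, J j → r j a b := fun a b => Iff.rfl
  obtain ⟨ρ, hρ0, hρ1, hb⟩ := hD.decayBound_of_map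
    (r := fun i : {i // ¬ J i} ⊕ {i // ¬ J i} =>
      Sum.elim (fun i => (r i.1).comap Prod.fst) (fun i => (r i.1).comap Prod.snd) i)
    (τ := fun x : Ω × Ω => τ x.1 * (τ x.2)⁻¹)
    (fun ω' => (h1 ω', h2 ω')) (Sum.elim (fun i => π1 i.1 i.2) (fun i => π2 i.1 i.2))
    (fun ω' => (hτ ω').symm)
    (by
      rintro (i | i) a b hab
      · exact hr1 _ i.2 a b hab
      · exact hr2 _ i.2 a b hab)
    (fun x => pairWeight R x.1 x.2) (fun x => pairWeight_nonneg R _ _)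
    (fun ω' => pairWeight_pos R ((hRiff _ _).2 fun j hj => hJ j hj ω'))
    (by
      rw [Fintype.sum_prod_type]
      simp only [sum_pairWeight, Finset.sum_const, Finset.card_univ, nsmul_eq_mul]
      field_simp)
  refine ⟨fun _ => 1 / (Fintype.card Ω : ℝ), √ρ, fun _ => by positivity, by simp,
    Real.sqrt_nonneg _, ?_, ?_⟩
  · rw [Real.sqrt_lt' one_pos]; simpa using hρ1
  intro N _ _ f hf
  have hcs := sq_norm_sum_mul_le R (N := N) (fun q => ∏ j : {j // J j}, f j q)
    (fun q => (∏ k, (τ (q k) : ℂ)) * ∏ i : {i // ¬ J i}, f i q)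
    (fun q => by
      rw [norm_prod]
      exact Finset.prod_le_one (fun _ _ => norm_nonneg _) fun i _ => hf.1 _ _)
    (fun q q' hqq => Finset.prod_congr rfl fun j _ => hf.2 _ _ _ fun k =>
      (hRiff _ _).1 (hqq k) j.1 j.2)
  have hleft : corr (fun _ => 1 / (Fintype.card Ω : ℝ)) τ f =
      ∑ q : N → Ω, ((∏ _k : N, (1 / (Fintype.card Ω : ℝ)) : ℝ) : ℂ) *
        (((∏ k, (τ (q k) : ℂ)) * ∏ i : {i // ¬ J i}, f i q) * ∏ j : {j // J j}, f j q) := by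
    unfold corr
    refine Finset.sum_congr rfl fun q _ => ?_
    rw [← Fintype.prod_subtype_mul_prod_subtype J (fun i => f i q)]
    ring
  rw [← hleft] at hcs
  have hbN := hb N (fun i q => Sum.elim (fun i : {i // ¬ J i} => f i (fun k => (q k).1))
    (fun i : {i // ¬ J i} => (starRingEnd ℂ) (f i.1 (fun k => (q k).2))) i) ?_
  · have hright : corr (fun x => pairWeight R x.1 x.2) (fun x : Ω × Ω => τ x.1 * (τ x.2)⁻¹)
        (fun i (q : N → Ω × Ω) => Sum.elim (fun i : {i // ¬ J i} => f i (fun k => (q k).1))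
          (fun i : {i // ¬ J i} => (starRingEnd ℂ) (f i (fun k => (q k).2))) i) =
        ∑ x : (N → Ω) × (N → Ω), ((∏ k, pairWeight R (x.1 k) (x.2 k) : ℝ) : ℂ) *
          (((∏ k, (τ (x.1 k) : ℂ)) * ∏ i : {i // ¬ J i}, f i x.1) *
            (starRingEnd ℂ) ((∏ k, (τ (x.2 k) : ℂ)) * ∏ i : {i // ¬ J i}, f i x.2)) := by
      unfold corr
      rw [← (Equiv.arrowProdEquivProdArrow N (fun _ => Ω) (fun _ => Ω)).symm.sum_comp]
      refine Finset.sum_congr rfl fun x _ => ?_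
      rw [Fintype.prod_sum_type]
      simp only [Equiv.arrowProdEquivProdArrow, Equiv.coe_fn_symm_mk, Sum.elim_inl, Sum.elim_inr,
        Circle.coe_mul, Circle.coe_inv_eq_conj, Finset.prod_mul_distrib, map_mul, map_prod]
      ring
    rw [← hright] at hcs
    refine (pow_le_pow_iff_left₀ (norm_nonneg _) (by positivity) two_ne_zero).1
      (hcs.trans (hbN.trans (le_of_eq ?_)))
    rw [← pow_mul, mul_comm, pow_mul, Real.sq_sqrt hρ0]
  · refine ⟨?_, ?_⟩
    · rintro (i | i) q
      · exact hf.1 _ _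
      · simpa using hf.1 i.1 _
    · rintro (i | i) q q' hqq
      · exact hf.2 _ _ _ hqq
      · exact congrArg (starRingEnd ℂ) (hf.2 _ _ _ hqq)

theorem decays_star_fin {L : ℕ} {Ω : Type*} [Fintype Ω] (r : Fin L → Setoid Ω) (τ : Ω → Circle)
    (s w₀ : Ω) (w : Fin L → Ω) (h0 : ∀ j, r j w₀ (w j)) (hs : ∀ i j, i ≠ j → r i (w j) s)
    (hτs : τ s = 1) (hτw : ∀ j, τ (w j) = 1) (hτ0 : τ w₀ ≠ 1) : Decays r τ := by
  classical
  induction L generalizing Ω with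
  | zero => exact decays_of_isEmpty r τ w₀ s (by rwa [hτs])
  | succ L ih =>
    let Ω' := {q : Ω × Ω // r 0 q.1 q.2}
    refine decays_of_double (Ω' := Ω') (r' := fun i : Fin L =>
        (r i.succ).comap (fun q => q.1.1) ⊓ (r i.succ).comap (fun q => q.1.2))
      (τ' := fun q => τ q.1.1 * (τ q.1.2)⁻¹) ?_ (fun i => i = 0) (fun q => q.1.1) (fun q => q.1.2)
      (by rintro j rfl q; exact q.2) (fun _ => rfl) (fun i hi => i.pred hi)
      (fun i hi => i.pred hi) ?_ ?_
    · refine ih _ _ ⟨(s, s), (r 0).refl s⟩ ⟨(w₀, w 0), h0 0⟩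
        (fun j => ⟨(w j.succ, s), hs 0 _ (Fin.succ_ne_zero j).symm⟩) ?_ ?_ ?_ ?_ ?_
      · exact fun j => ⟨h0 _, hs _ _ (Fin.succ_ne_zero j)⟩
      · exact fun i j hij => ⟨hs _ _ fun h => hij (Fin.succ_injective _ h), (r _).refl _⟩
      · simp
      · intro j; simp [hτs, hτw]
      · simpa [hτw] using hτ0
    · intro i hi a b hab
      have : r (i.pred hi).succ a.1.1 b.1.1 := hab.1
      rwa [Fin.succ_pred] at this
    · intro i hi a b hab
      have : r (i.pred hi).succ a.1.2 b.1.2 := hab.2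
      rwa [Fin.succ_pred] at this

/-- A star of points of trivial phase around a point of nontrivial phase gives decay. -/
theorem decays_star {ι Ω : Type*} [Fintype ι] [Fintype Ω] (r : ι → Setoid Ω) (τ : Ω → Circle)
    (s w₀ : Ω) (w : ι → Ω) (h0 : ∀ j, r j w₀ (w j)) (hs : ∀ i j, i ≠ j → r i (w j) s)
    (hτs : τ s = 1) (hτw : ∀ j, τ (w j) = 1) (hτ0 : τ w₀ ≠ 1) : Decays r τ := by
  let e := Fintype.equivFin ι
  refine (decays_star_fin (fun i => r (e.symm i)) τ s w₀ (fun i => w (e.symm i)) (fun _ => h0 _)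
    (fun i j hij => hs _ _ fun h => hij (e.symm.injective h)) hτs (fun _ => hτw _) hτ0).of_map
    id e (fun _ => rfl) ?_
  intro i a b hab
  have : r (e.symm (e i)) a b := hab
  rwa [e.symm_apply_apply] at this

/-- The relation that consecutive points of a chain satisfy at step `t`. -/
def linkRel {Ω : Type*} (l r : Setoid Ω) (t : ℕ) : Setoid Ω := if Even t then r else l

/-- Sequences of `K` points, linked alternately by `r` and `l`. -/
def Chain {Ω : Type*} (l r : Setoid Ω) (K : ℕ) : Type _ :=
  {q : Fin K → Ω // ∀ s t : Fin K, s.1 + 1 = t.1 → linkRel l r s.1 (q s) (q t)}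

/-- Chains whose last point is linked by `l` to the first. -/
def Cyc {Ω : Type*} (l r : Setoid Ω) (K : ℕ) : Type _ :=
  {q : Chain l r K // ∀ s t : Fin K, s.1 = 0 → t.1 + 1 = K → l (q.1 s) (q.1 t)}

noncomputable instance {Ω : Type*} [Fintype Ω] (l r : Setoid Ω) (K : ℕ) : Fintype (Chain l r K) :=
  open Classical in inferInstanceAs (Fintype (Subtype _))

noncomputable instance {Ω : Type*} [Fintype Ω] (l r : Setoid Ω) (K : ℕ) : Fintype (Cyc l r K) :=
  open Classical in inferInstanceAs (Fintype (Subtype _))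

/-- The inverse of a phase at odd places. -/
noncomputable def alt (t : ℕ) (z : Circle) : Circle := if Even t then z else z⁻¹

/-- The alternating product of the phases along a chain. -/
noncomputable def chainPhase {Ω : Type*} {l r : Setoid Ω} {K : ℕ} (τ : Ω → Circle) (q : Chain l r K) : Circle :=
  ∏ t : Fin K, alt t.1 (τ (q.1 t))

/-- The two end blocks `l`, `r` followed by the letters `c`. -/
def ends {Ω I : Type*} (l r : Setoid Ω) (c : I → Setoid Ω) : Bool ⊕ I → Setoid Ω
  | .inl false => l
  | .inl true => r
  | .inr i => c i

/-- The ends of a chain of length `K` and the letters of its points. -/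
def chainBlocks {Ω I : Type*} (l r : Setoid Ω) (c : I → Setoid Ω) (K : ℕ) :
    Bool ⊕ (Fin K × I) → Setoid (Chain l r K)
  | .inl false =>
    ⟨fun q q' => ∀ t : Fin K, t.1 = 0 → l (q.1 t) (q'.1 t), fun _ _ _ => l.refl _,
      fun h t ht => l.symm (h t ht), fun h h' t ht => l.trans (h t ht) (h' t ht)⟩
  | .inl true =>
    ⟨fun q q' => ∀ t : Fin K, t.1 + 1 = K → l (q.1 t) (q'.1 t), fun _ _ _ => l.refl _,
      fun h t ht => l.symm (h t ht), fun h h' t ht => l.trans (h t ht) (h' t ht)⟩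
  | .inr (t, i) => (c i).comap fun q => q.1 t

/-- The letters of the points of a cycle. -/
def cycBlocks {Ω I : Type*} (l r : Setoid Ω) (c : I → Setoid Ω) (K : ℕ) :
    Fin K × I → Setoid (Cyc l r K) :=
  fun x => (c x.2).comap fun q => q.1.1 x.1

section Chain

variable {Ω I : Type*} {l r : Setoid Ω} {c : I → Setoid Ω}
  {τ : Ω → Circle}

/-- The first half of a chain. -/
def Chain.left {K : ℕ} (q : Chain l r (K + K)) : Chain l r K :=
  ⟨fun t => q.1 (Fin.castAdd K t), fun _ _ h => q.2 _ _ h⟩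

/-- The second half of a chain, read backwards. -/
def Chain.right {K : ℕ} (q : Chain l r (K + K)) : Chain l r K :=
  ⟨fun t => q.1 (Fin.natAdd K t.rev), fun s t h => by
    have h1 := q.2 (Fin.natAdd K t.rev) (Fin.natAdd K s.rev) (by
      simp only [Fin.val_natAdd, Fin.val_rev]; omega)
    have h2 : linkRel l r (Fin.natAdd K t.rev).1 = linkRel l r s.1 := by
      unfold linkRel
      have : (Even (Fin.natAdd K t.rev).1) ↔ Even s.1 := by
        simp only [Fin.val_natAdd, Fin.val_rev]
        have := t.2
        rw [show K + (K - (t.1 + 1)) = 2 * (K - t.1) + s.1 by omega, Nat.even_add]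
        simp
      simp only [this]
    rw [h2] at h1
    exact (linkRel l r s.1).symm h1⟩

theorem chainPhase_left_right {K : ℕ} (hK : Even K) (q : Chain l r (K + K)) :
    chainPhase τ q = chainPhase τ q.left * (chainPhase τ q.right)⁻¹ := by
  unfold chainPhase
  rw [Fin.prod_univ_add, ← Finset.prod_inv_distrib]
  congr 1
  rw [← Equiv.prod_comp Fin.revPerm]
  refine Finset.prod_congr rfl fun t _ => ?_
  simp only [Fin.revPerm_apply, Chain.right, alt, Fin.val_natAdd, Fin.val_rev]
  have : Even (K + (K - (t.1 + 1))) ↔ ¬ Even t.1 := by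
    have := t.2
    rw [Nat.even_add, Nat.even_sub (by omega), Nat.even_add_one]
    simp [hK]
  simp only [this]
  split_ifs <;> simp_all

theorem decays_of_chain [Fintype Ω] [Fintype I] (k : ℕ)
    (h : Decays (chainBlocks l r c (2 ^ (k + 1))) (chainPhase τ)) : Decays (ends l r c) τ := by
  induction k with
  | zero =>
    refine decays_of_double h (fun i => i = .inl true) (fun q => q.1 (0 : Fin 2))
      (fun q => q.1 (1 : Fin 2)) ?_ ?_
      (fun i _ => match i with
        | .inl _ => .inl false
        | .inr i => .inr ((0 : Fin 2), i))
      (fun i _ => match i with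
        | .inl _ => .inl true
        | .inr i => .inr ((1 : Fin 2), i)) ?_ ?_
    · rintro j rfl q
      exact q.2 (0 : Fin 2) (1 : Fin 2) rfl
    · intro q
      refine (Fin.prod_univ_two _).trans ?_
      simp [alt]
    · rintro ((_ | _) | i) hi a b hab
      · exact hab (0 : Fin 2) rfl
      · exact absurd rfl hi
      · exact hab
    · rintro ((_ | _) | i) hi a b hab
      · exact hab (1 : Fin 2) rfl
      · exact absurd rfl hi
      · exact hab
  | succ k ih =>
    apply ih
    generalize hK : 2 ^ (k + 1) = K at *
    have hpow : 2 ^ (k + 1 + 1) = K + K := by rw [← hK]; ring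
    have hev : Even K := by rw [← hK]; exact (even_two.pow_of_ne_zero (by omega))
    have hpos : 0 < K := by rw [← hK]; positivity
    rw [hpow] at h
    refine decays_of_double h (fun i => i = .inl true) Chain.left Chain.right ?_
      (chainPhase_left_right hev)
      (fun i _ => match i with
        | .inl _ => .inl false
        | .inr (t, i) => .inr (Fin.castAdd K t, i))
      (fun i _ => match i with
        | .inl _ => .inl true
        | .inr (t, i) => .inr (Fin.natAdd K t.rev, i)) ?_ ?_
    · rintro j rfl q t ht
      have h1 := q.2 (Fin.castAdd K t) (Fin.natAdd K t.rev) (by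
        simp only [Fin.val_natAdd, Fin.val_rev, Fin.val_castAdd]; omega)
      have h2 : ¬ Even (Fin.castAdd K t).1 := by
        simp only [Fin.val_castAdd]
        rw [← ht, Nat.even_add_one] at hev
        exact hev
      rwa [linkRel, if_neg h2] at h1
    · rintro ((_ | _) | ⟨t, i⟩) hi a b hab
      · exact fun t ht => hab _ ht
      · exact absurd rfl hi
      · exact hab
    · rintro ((_ | _) | ⟨t, i⟩) hi a b hab
      · exact fun t ht => hab _ (by simp only [Fin.val_natAdd, Fin.val_rev]; omega)
      · exact absurd rfl hi
      · exact hab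

theorem decays_of_cyc [Fintype Ω] [Fintype I] (k : ℕ)
    (h : Decays (cycBlocks l r c (2 ^ (k + 2))) (fun q => chainPhase τ q.1)) :
    Decays (ends l r c) τ := by
  apply decays_of_chain k
  generalize hK : 2 ^ (k + 1) = K at *
  have hpow : 2 ^ (k + 2) = K + K := by rw [← hK]; ring
  have hev : Even K := by rw [← hK]; exact (even_two.pow_of_ne_zero (by omega))
  rw [hpow] at h
  refine decays_of_double h (fun i => i.isLeft) (fun q => q.1.left) (fun q => q.1.right) ?_
    (fun q => chainPhase_left_right hev q.1)
    (fun i _ => match i with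
      | .inl b => False.elim (by simp_all)
      | .inr (t, i) => (Fin.castAdd K t, i))
    (fun i _ => match i with
      | .inl b => False.elim (by simp_all)
      | .inr (t, i) => (Fin.natAdd K t.rev, i)) ?_ ?_
  · rintro ((_ | _) | i) hi q
    · intro t ht
      exact q.2 (Fin.castAdd K t) (Fin.natAdd K t.rev) ht (by
        simp only [Fin.val_natAdd, Fin.val_rev]; omega)
    · intro t ht
      have h1 := q.1.2 (Fin.castAdd K t) (Fin.natAdd K t.rev) (by
        simp only [Fin.val_natAdd, Fin.val_rev, Fin.val_castAdd]; omega)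
      have h2 : ¬ Even (Fin.castAdd K t).1 := by
        simp only [Fin.val_castAdd]
        rw [← ht, Nat.even_add_one] at hev
        exact hev
      rwa [linkRel, if_neg h2] at h1
    · simp at hi
  · rintro (_ | ⟨t, i⟩) hi a b hab
    · simp at hi
    · exact hab
  · rintro (_ | ⟨t, i⟩) hi a b hab
    · simp at hi
    · exact hab

end Chain

open Finset in
theorem exists_perm_of_card_fiber_eq {T A : Type*} [Fintype T] [DecidableEq A] (u v : T → A)
    (h : ∀ x, (univ.filter (fun t => u t = x)).card = (univ.filter (fun t => v t = x)).card) :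
    ∃ π : Equiv.Perm T, ∀ t, v (π t) = u t := by
  have : ∀ x, Nonempty ({t // u t = x} ≃ {t // v t = x}) := fun x => by
    refine Fintype.card_eq.1 ?_
    rw [Fintype.card_subtype, Fintype.card_subtype, h]
  exact ⟨Equiv.ofFiberEquiv fun x => (this x).some, fun t => Equiv.ofFiberEquiv_map _ t⟩

noncomputable instance : DivisibleBy (Additive Circle) ℤ :=
  divisibleByOfSMulRightSurj _ _ fun {n} hn z => by
    obtain ⟨x, hx⟩ := Circle.exp_surjective z.toMul
    refine ⟨Circle.expHom (x / n), ?_⟩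
    have hn' : (n : ℝ) ≠ 0 := by exact_mod_cast hn
    show n • Circle.expHom (x / n) = z
    rw [← map_zsmul, zsmul_eq_mul, mul_div_cancel₀ _ hn']
    exact hx

theorem exists_extension {G H D : Type*} [AddCommGroup G] [AddCommGroup H] [AddCommGroup D]
    [DivisibleBy D ℤ] (f : G →+ H) (θ : G →+ D) (h : f.ker ≤ θ.ker) :
    ∃ ψ : H →+ D, ∀ g, ψ (f g) = θ g := by
  obtain ⟨ψ, hψ⟩ := (Module.Baer.of_divisible D).extension_property_addMonoidHom
    (QuotientAddGroup.kerLift f) (QuotientAddGroup.kerLift_injective f)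
    (QuotientAddGroup.lift f.ker θ h)
  refine ⟨ψ, fun g => ?_⟩
  have := DFunLike.congr_fun hψ (g : G ⧸ f.ker)
  simpa using this

@[to_additive]
theorem prod_range_mul_four {M : Type*} [CommMonoid M] (f : ℕ → M) (n : ℕ) :
    ∏ t ∈ Finset.range (4 * n), f t =
      ∏ i ∈ Finset.range n, (f (4 * i) * f (4 * i + 1) * f (4 * i + 2) * f (4 * i + 3)) := by
  induction n with
  | zero => simp
  | succ n ih =>
    rw [Finset.prod_range_succ, ← ih, show 4 * (n + 1) = 4 * n + 1 + 1 + 1 + 1 by ring,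
      Finset.prod_range_succ, Finset.prod_range_succ, Finset.prod_range_succ,
      Finset.prod_range_succ]
    simp only [mul_assoc]

section Potential

variable {Q A : Type*} {a1 a2 a3 a4 : Q → A} {τ : Q → Circle}

/-- The letter of a point that counts positively at place `t`. -/
def plusLetter (a2 a3 : Q → A) (t : ℕ) : Q → A := if Even t then a3 else a2

theorem linkRel_ker {t : ℕ} {ω ω' : Q} :
    linkRel (Setoid.ker a1) (Setoid.ker a4) t ω ω' ↔
      plusLetter a1 a4 t ω = plusLetter a1 a4 t ω' := by
  by_cases h : Even t
  · rw [linkRel, plusLetter, if_pos h, if_pos h]; exact Setoid.ker_def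
  · rw [linkRel, plusLetter, if_neg h, if_neg h]; exact Setoid.ker_def

theorem exists_cyc_of_letters [Fintype Q]
    (T1 : ∀ x y, ∃ ω, a1 ω = x ∧ a2 ω = x ∧ a3 ω = y ∧ a4 ω = y ∧ τ ω = 1)
    (T2 : ∀ x y, ∃ ω, a1 ω = x ∧ a2 ω = y ∧ a3 ω = y ∧ a4 ω = x ∧ τ ω = 1)
    {K : ℕ} (hK : Even K) (S : ℕ → A) (m p : Fin K → A) (hS : S 0 = S K)
    (h : ∀ t : Fin K, (S t = m t ∧ S (t + 1) = p t) ∨ (S t = S (t + 1) ∧ m t = p t)) :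
    ∃ q : Cyc (Setoid.ker a1) (Setoid.ker a4) K,
      (∀ t : Fin K, plusLetter a3 a2 t (q.1.1 t) = m t ∧ plusLetter a2 a3 t (q.1.1 t) = p t) ∧
      chainPhase τ q.1 = 1 := by
  have hslot : ∀ t : Fin K, ∃ ω, plusLetter a3 a2 t ω = m t ∧ plusLetter a2 a3 t ω = p t ∧
      plusLetter a4 a1 t ω = S t ∧ plusLetter a1 a4 t ω = S (t + 1) ∧ τ ω = 1 := by
    intro t
    unfold plusLetter
    rcases h t with ⟨e1, e2⟩ | ⟨e1, e2⟩ <;> split_ifs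
    · obtain ⟨ω, h1, h2, h3, h4, h5⟩ := T1 (S t) (S (t + 1))
      exact ⟨ω, h2.trans e1, h3.trans e2, h1, h4, h5⟩
    · obtain ⟨ω, h1, h2, h3, h4, h5⟩ := T1 (S (t + 1)) (S t)
      exact ⟨ω, h3.trans e1, h2.trans e2, h4, h1, h5⟩
    · obtain ⟨ω, h1, h2, h3, h4, h5⟩ := T2 (S t) (m t)
      exact ⟨ω, h2, h3.trans e2, h1, h4.trans e1, h5⟩
    · obtain ⟨ω, h1, h2, h3, h4, h5⟩ := T2 (S t) (m t)
      exact ⟨ω, h3, h2.trans e2, h4, h1.trans e1, h5⟩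
  choose q hm hp ht hh hτ using hslot
  have hflip : ∀ t (ω : Q), plusLetter a4 a1 (t + 1) ω = plusLetter a1 a4 t ω := by
    intro t ω
    unfold plusLetter
    simp only [Nat.even_add_one]
    split_ifs <;> simp_all
  refine ⟨⟨⟨q, fun s t hst => ?_⟩, fun s t hs htK => ?_⟩, fun t => ⟨hm t, hp t⟩, ?_⟩
  · rw [linkRel_ker, hh, ← hflip, hst, ht]
  · have h1 := ht s
    have h2 := hh t
    have ho : ¬ Even t.1 := by rw [← htK, Nat.even_add_one] at hK; exact hK
    rw [hs, ← hS.symm] at h1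
    rw [htK] at h2
    unfold plusLetter at h1 h2
    rw [if_pos (by simp)] at h1
    rw [if_neg ho] at h2
    exact Setoid.ker_def.2 (h1.trans h2.symm)
  · unfold chainPhase
    refine Finset.prod_eq_one fun t _ => ?_
    simp [hτ, alt]

/-- A cyclic word with as many positive as negative occurrences of each letter, and nontrivial
phase, gives decay. -/
theorem decays_of_balanced [Fintype Q]
    (T1 : ∀ x y, ∃ ω, a1 ω = x ∧ a2 ω = x ∧ a3 ω = y ∧ a4 ω = y ∧ τ ω = 1)
    (T2 : ∀ x y, ∃ ω, a1 ω = x ∧ a2 ω = y ∧ a3 ω = y ∧ a4 ω = x ∧ τ ω = 1)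
    (k : ℕ) (w : Cyc (Setoid.ker a1) (Setoid.ker a4) (2 ^ (k + 2))) (a0 : A)
    (π : Equiv.Perm (Fin (2 ^ (k + 2))))
    (hπ : ∀ t, plusLetter a3 a2 (π t) (w.1.1 (π t)) = plusLetter a2 a3 t (w.1.1 t))
    (hw : chainPhase τ w.1 ≠ 1) :
    Decays (ends (Setoid.ker a1) (Setoid.ker a4)
      fun b : Bool => Setoid.ker (if b then a3 else a2)) τ := by
  classical
  apply decays_of_cyc k
  have hK : Even (2 ^ (k + 2)) := even_two.pow_of_ne_zero (by omega)
  generalize 2 ^ (k + 2) = K at *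
  let r' : Fin K → Setoid (Cyc (Setoid.ker a1) (Setoid.ker a4) K) := fun t =>
    Setoid.ker (fun q => plusLetter a2 a3 t (q.1.1 t)) ⊓
      Setoid.ker (fun q => plusLetter a3 a2 (π t) (q.1.1 (π t)))
  obtain ⟨s, hs, hsτ⟩ := exists_cyc_of_letters T1 T2 hK (fun _ => a0) (fun _ => a0) (fun _ => a0)
    rfl (fun _ => .inl ⟨rfl, rfl⟩)
  have hstar : ∀ t : Fin K, ∃ q : Cyc (Setoid.ker a1) (Setoid.ker a4) K,
      (∀ i : Fin K, plusLetter a3 a2 i (q.1.1 i) =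
        (if i = π t then plusLetter a2 a3 t (w.1.1 t) else a0) ∧
        plusLetter a2 a3 i (q.1.1 i) = (if i = t then plusLetter a2 a3 t (w.1.1 t) else a0)) ∧
      chainPhase τ q.1 = 1 := by
    intro t
    have := t.2
    have := (π t).2
    refine exists_cyc_of_letters T1 T2 hK
      (fun i => if t < π t then (if t.1 < i ∧ i ≤ (π t).1 then plusLetter a2 a3 t (w.1.1 t) else a0)
        else (if (π t).1 < i ∧ i ≤ t.1 then a0 else plusLetter a2 a3 t (w.1.1 t))) _ _ ?_ ?_
    · split_ifs <;> first | rfl | omega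
    · intro i
      generalize plusLetter a2 a3 t (w.1.1 t) = x
      simp only [Fin.lt_def, Fin.ext_iff]
      split_ifs <;> first | omega | simp
  choose wt hwt hwtτ using hstar
  refine (decays_star r' (fun q => chainPhase τ q.1) s w wt ?_ ?_ hsτ hwtτ hw).of_map id
    (fun x => if x.2 = decide (Even x.1.1) then x.1 else π.symm x.1) (fun _ => rfl) ?_
  · intro t
    refine ⟨Setoid.ker_def.2 ?_, Setoid.ker_def.2 ?_⟩
    · rw [(hwt t t).2, if_pos rfl]
    · rw [(hwt t (π t)).1, if_pos rfl, hπ]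
  · intro i t hit
    refine ⟨Setoid.ker_def.2 ?_, Setoid.ker_def.2 ?_⟩
    · rw [(hwt t i).2, if_neg hit, (hs i).2]
    · rw [(hwt t (π i)).1, if_neg (fun h => hit (π.injective h)), (hs _).1]
  · rintro ⟨t, b⟩ q q' h
    change r' (if b = decide (Even t.1) then t else π.symm t) q q' at h
    change Setoid.ker (if b then a3 else a2) (q.1.1 t) (q'.1.1 t)
    rw [Setoid.ker_def]
    by_cases hb : b = decide (Even t.1)
    · rw [if_pos hb] at h
      have := Setoid.ker_def.1 h.1
      simpa [hb, plusLetter, ite_apply] using this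
    · rw [if_neg hb] at h
      have := Setoid.ker_def.1 h.2
      rw [Equiv.apply_symm_apply] at this
      have hb' : b = !decide (Even t.1) := by
        cases b <;> simp_all
      by_cases he : Even t.1
      · simpa [hb', plusLetter, he] using this
      · simpa [hb', plusLetter, he] using this

end Potential

/-- Every integer combination is a sum of signed generators, listed with a prescribed padding. -/
theorem exists_signed_sequence {Q : Type*} (d : Q × Bool) (n : Q →₀ ℤ) :
    ∃ (M : ℕ) (e : ℕ → Q × Bool), (∀ i, M ≤ i → e i = d) ∧ n = ∑ i ∈ Finset.range M,
      (if (e i).2 then Finsupp.single (e i).1 1 else -Finsupp.single (e i).1 1) := by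
  have hlist : ∃ L : List (Q × Bool), n = (L.map fun x =>
      if x.2 then Finsupp.single x.1 (1 : ℤ) else -Finsupp.single x.1 1).sum := by
    induction n using Finsupp.induction_linear with
    | zero => exact ⟨[], by simp⟩
    | add f g hf hg =>
      obtain ⟨L, hL⟩ := hf
      obtain ⟨L', hL'⟩ := hg
      exact ⟨L ++ L', by rw [List.map_append, List.sum_append, ← hL, ← hL']⟩
    | single a z =>
      obtain ⟨k, rfl | rfl⟩ := z.eq_nat_or_neg
      · exact ⟨List.replicate k (a, true), by simp⟩
      · exact ⟨List.replicate k (a, false), by simp⟩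
  obtain ⟨L, hL⟩ := hlist
  refine ⟨L.length, fun i => L.getD i d, fun i hi => List.getD_eq_default _ _ hi, ?_⟩
  rw [Finset.sum_range, hL, ← Fin.sum_univ_fun_getElem]
  refine Finset.sum_congr rfl fun i _ => ?_
  simp only [List.getD_eq_getElem _ _ i.2]

section Potential

variable {Q A : Type*} {a1 a2 a3 a4 : Q → A} {τ : Q → Circle}

/-- The alternating sum of the labels of a combination of points. -/
noncomputable def boundary (a1 a2 a3 a4 : Q → A) : (Q →₀ ℤ) →+ (A →₀ ℤ) :=
  Finsupp.liftAddHom fun ω => (zmultiplesHom (A →₀ ℤ)) (Finsupp.single (a1 ω) 1 -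
    Finsupp.single (a2 ω) 1 + Finsupp.single (a3 ω) 1 - Finsupp.single (a4 ω) 1)

/-- The product of the phases of a combination of points. -/
noncomputable def totalPhase (τ : Q → Circle) : (Q →₀ ℤ) →+ Additive Circle :=
  Finsupp.liftAddHom fun ω => (zmultiplesHom (Additive Circle)) (Additive.ofMul (τ ω))

theorem boundary_single (ω : Q) : boundary a1 a2 a3 a4 (Finsupp.single ω 1) =
    Finsupp.single (a1 ω) 1 - Finsupp.single (a2 ω) 1 + Finsupp.single (a3 ω) 1 -
      Finsupp.single (a4 ω) 1 := by
  simp [boundary]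

theorem totalPhase_single (ω : Q) :
    totalPhase τ (Finsupp.single ω 1) = Additive.ofMul (τ ω) := by
  simp [totalPhase]

/-- The four places of a word that carry a signed point. -/
def slotWord (a1 a4 : Q → A) (T : A → A → Q) (a0 : A) (x : Q × Bool) (j : ℕ) : Q :=
  if x.2 then
    match j with
    | 0 => T a0 (a1 x.1)
    | 1 => T (a1 x.1) (a1 x.1)
    | 2 => x.1
    | _ => T a0 (a4 x.1)
  else
    match j with
    | 0 => T a0 (a4 x.1)
    | 1 => x.1
    | 2 => T (a1 x.1) (a1 x.1)
    | _ => T a0 (a1 x.1)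

theorem decays_of_sequence [Fintype Q]
    (T1 : ∀ x y, ∃ ω, a1 ω = x ∧ a2 ω = x ∧ a3 ω = y ∧ a4 ω = y ∧ τ ω = 1)
    (T2 : ∀ x y, ∃ ω, a1 ω = x ∧ a2 ω = y ∧ a3 ω = y ∧ a4 ω = x ∧ τ ω = 1)
    (a0 : A) (k : ℕ) (e : ℕ → Q × Bool)
    (hbd : ∑ i ∈ Finset.range (2 ^ k), boundary a1 a2 a3 a4
      (if (e i).2 then Finsupp.single (e i).1 1 else -Finsupp.single (e i).1 1) = 0)
    (hph : ∑ i ∈ Finset.range (2 ^ k), totalPhase τ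
      (if (e i).2 then Finsupp.single (e i).1 1 else -Finsupp.single (e i).1 1) ≠ 0) :
    Decays (ends (Setoid.ker a1) (Setoid.ker a4)
      fun b : Bool => Setoid.ker (if b then a3 else a2)) τ := by
  classical
  choose T hT1 hT2 hT3 hT4 hTτ using T1
  let q : ℕ → Q := fun t => slotWord a1 a4 T a0 (e (t / 4)) (t % 4)
  have hq : ∀ i j, j < 4 → q (4 * i + j) = slotWord a1 a4 T a0 (e i) j := by
    intro i j hj
    simp only [q]
    rw [show (4 * i + j) / 4 = i by omega, show (4 * i + j) % 4 = j by omega]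
  have hq0 : ∀ i, q (4 * i) = if (e i).2 then T a0 (a1 (e i).1) else T a0 (a4 (e i).1) :=
    fun i => hq i 0 (by norm_num)
  have hq1 : ∀ i, q (4 * i + 1) = if (e i).2 then T (a1 (e i).1) (a1 (e i).1) else (e i).1 :=
    fun i => hq i 1 (by norm_num)
  have hq2 : ∀ i, q (4 * i + 2) = if (e i).2 then (e i).1 else T (a1 (e i).1) (a1 (e i).1) :=
    fun i => hq i 2 (by norm_num)
  have hq3 : ∀ i, q (4 * i + 3) = if (e i).2 then T a0 (a4 (e i).1) else T a0 (a1 (e i).1) :=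
    fun i => hq i 3 (by norm_num)
  have he0 : ∀ i, Even (4 * i) := fun i => ⟨2 * i, by ring⟩
  have he1 : ∀ i, ¬ Even (4 * i + 1) := fun i => by simp [Nat.even_add_one, he0]
  have he2 : ∀ i, Even (4 * i + 2) := fun i => by simp [Nat.even_add, he0]
  have he3 : ∀ i, ¬ Even (4 * i + 3) := fun i => by
    rw [show 4 * i + 3 = 4 * i + 2 + 1 by ring, Nat.even_add_one, not_not]; exact he2 i
  have hstart : ∀ i, a1 (q (4 * i)) = a0 := by
    intro i; rw [hq0]; split_ifs <;> simp [hT1]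
  have hend : ∀ i, a1 (q (4 * i + 3)) = a0 := by
    intro i; rw [hq3]; split_ifs <;> simp [hT1]
  have hlink : ∀ t, plusLetter a1 a4 t (q t) = plusLetter a1 a4 t (q (t + 1)) := by
    intro t
    obtain ⟨i, hi⟩ : ∃ i, t = 4 * i ∨ t = 4 * i + 1 ∨ t = 4 * i + 2 ∨ t = 4 * i + 3 :=
      ⟨t / 4, by omega⟩
    rcases hi with rfl | rfl | rfl | rfl
    · rw [hq0, hq1]
      simp only [plusLetter, he0, if_true]
      split_ifs <;> simp [hT4]
    · rw [hq1, hq2]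
      simp only [plusLetter, he1, if_false]
      split_ifs <;> simp [hT1]
    · rw [hq2, hq3]
      simp only [plusLetter, he2, if_true]
      split_ifs <;> simp [hT4]
    · rw [plusLetter, if_neg (he3 i), hend, show 4 * i + 3 + 1 = 4 * (i + 1) by ring, hstart]
  have hK4 : 2 ^ (k + 2) = 4 * 2 ^ k := by ring
  have hKpos : 0 < 2 ^ k := by positivity
  let w : Cyc (Setoid.ker a1) (Setoid.ker a4) (2 ^ (k + 2)) :=
    ⟨⟨fun t => q t, fun s t hst => linkRel_ker.2 (by
      show plusLetter a1 a4 s (q s) = plusLetter a1 a4 s (q t)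
      rw [← hst]; exact hlink s)⟩,
      fun s t hs ht => Setoid.ker_def.2 (by
        have ht' : t.1 = 4 * (2 ^ k - 1) + 3 := by omega
        show a1 (q s) = a1 (q t)
        rw [hs, ht', hend, show 0 = 4 * 0 from rfl, hstart])⟩
  have hbal : ∑ t ∈ Finset.range (2 ^ (k + 2)), (Finsupp.single (plusLetter a2 a3 t (q t)) (1 : ℤ) -
      Finsupp.single (plusLetter a3 a2 t (q t)) 1) = 0 := by
    rw [hK4, sum_range_add_four, ← hbd]
    refine Finset.sum_congr rfl fun i _ => ?_
    simp only [plusLetter, he0, he1, he2, he3, if_true, if_false, hq0, hq1, hq2, hq3]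
    split_ifs
    · simp only [hT2, hT3, boundary_single]; abel
    · simp only [hT2, hT3, map_neg, boundary_single]; abel
  have hcard : ∀ x, (Finset.univ.filter (fun t : Fin (2 ^ (k + 2)) =>
        plusLetter a2 a3 t (w.1.1 t) = x)).card =
      (Finset.univ.filter (fun t : Fin (2 ^ (k + 2)) =>
        plusLetter a3 a2 t (w.1.1 t) = x)).card := by
    intro x
    have h := DFunLike.congr_fun hbal x
    rw [Finset.sum_range, Finsupp.finsetSum_apply] at h
    simp only [Finsupp.coe_sub, Pi.sub_apply, Finset.sum_sub_distrib, Finsupp.single_apply,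
      Finset.sum_boole, Finsupp.coe_zero, Pi.zero_apply] at h
    have h' := sub_eq_zero.1 h
    exact_mod_cast h'
  obtain ⟨π, hπ⟩ := exists_perm_of_card_fiber_eq _ _ hcard
  refine decays_of_balanced (fun x y => ⟨T x y, hT1 x y, hT2 x y, hT3 x y, hT4 x y, hTτ x y⟩) T2 k w
    a0 π hπ fun hw => hph ?_
  have hw' : ∏ t ∈ Finset.range (2 ^ (k + 2)), alt t (τ (q t)) = 1 := by
    rw [Finset.prod_range]; exact hw
  rw [hK4, prod_range_mul_four] at hw'
  have := congrArg Additive.ofMul hw'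
  rw [ofMul_prod, ofMul_one] at this
  rw [← this]
  refine Finset.sum_congr rfl fun i _ => ?_
  simp only [alt, he0, he1, he2, he3, if_true, if_false, hq0, hq1, hq2, hq3]
  split_ifs
  · simp [hTτ, totalPhase_single]
  · simp [hTτ, totalPhase_single]

/-- If there is no decay, the phase splits over the four labels. -/
theorem exists_potential [Fintype Q]
    (T1 : ∀ x y, ∃ ω, a1 ω = x ∧ a2 ω = x ∧ a3 ω = y ∧ a4 ω = y ∧ τ ω = 1)
    (T2 : ∀ x y, ∃ ω, a1 ω = x ∧ a2 ω = y ∧ a3 ω = y ∧ a4 ω = x ∧ τ ω = 1)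
    (h : ¬ Decays (ends (Setoid.ker a1) (Setoid.ker a4)
      fun b : Bool => Setoid.ker (if b then a3 else a2)) τ) :
    ∃ φ : A → Circle, ∀ ω, τ ω = φ (a1 ω) * (φ (a2 ω))⁻¹ * φ (a3 ω) * (φ (a4 ω))⁻¹ := by
  have hker : (boundary a1 a2 a3 a4).ker ≤ (totalPhase τ).ker := by
    intro n hn
    by_contra hne
    rw [AddMonoidHom.mem_ker] at hn hne
    have hA : Nonempty A := by
      by_contra hA
      rw [not_nonempty_iff] at hA
      have : IsEmpty Q := Function.isEmpty a1
      exact hne (by rw [Subsingleton.elim n 0, map_zero])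
    obtain ⟨a0⟩ := hA
    obtain ⟨d, hd1, hd2, hd3, hd4, hdτ⟩ := T1 a0 a0
    obtain ⟨M, e, he, rfl⟩ := exists_signed_sequence (d, true) n
    obtain ⟨k, hk⟩ : ∃ k, M ≤ 2 ^ k := ⟨M, Nat.lt_two_pow_self.le⟩
    have hsub : Finset.range M ⊆ Finset.range (2 ^ k) := Finset.range_subset_range.2 hk
    rw [map_sum] at hn hne
    refine h (decays_of_sequence T1 T2 a0 k e ?_ ?_)
    · rw [← hn]
      refine (Finset.sum_subset hsub fun i _ hi => ?_).symm
      rw [he i (by simpa using hi), if_pos rfl, boundary_single]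
      simp [hd1, hd2, hd3, hd4]
    · convert hne using 1
      refine (Finset.sum_subset hsub fun i _ hi => ?_).symm
      rw [he i (by simpa using hi), if_pos rfl, totalPhase_single, hdτ]
      simp
  obtain ⟨ψ, hψ⟩ := exists_extension _ _ hker
  refine ⟨fun a => (ψ (Finsupp.single a 1)).toMul, fun ω => ?_⟩
  have := hψ (Finsupp.single ω 1)
  rw [boundary_single, totalPhase_single, map_sub, map_add, map_sub] at this
  have h2 := congrArg Additive.toMul this
  simp only [toMul_ofMul, toMul_sub, toMul_add] at h2
  rw [← h2]
  simp only [div_eq_mul_inv]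

end Potential

section Walks

variable {Ω : Type*} {l r c : Setoid Ω} {τ : Ω → Circle}

/-- The initial segment of a linked sequence. -/
def Chain.ofSeq (q : ℕ → Ω) (hq : ∀ t, linkRel l r t (q t) (q (t + 1))) (K : ℕ) : Chain l r K :=
  ⟨fun t => q t, fun s t hst => by
    have := hq s
    rwa [hst] at this⟩

/-- The constant chain. -/
def Chain.const (l r : Setoid Ω) (K : ℕ) (ω : Ω) : Chain l r K :=
  ⟨fun _ => ω, fun _ _ _ => Setoid.refl' _ _⟩

/-- The chain `ω, ω', ω', …`. -/
def Chain.step {ω ω' : Ω} (h : r ω ω') (K : ℕ) : Chain l r K :=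
  ⟨fun t => if t.1 = 0 then ω else ω', fun s t hst => by
    show linkRel l r s.1 (if s.1 = 0 then ω else ω') (if t.1 = 0 then ω else ω')
    rw [if_neg (show ¬ t.1 = 0 by omega)]
    split_ifs with h0
    · rw [linkRel, if_pos (by simp [h0])]; exact h
    · exact Setoid.refl' _ _⟩

theorem prod_alt_const {K : ℕ} (hK : Even K) (z : Circle) : ∏ t : Fin K, alt t.1 z = 1 := by
  rw [Fin.prod_univ_eq_prod_range (fun t => alt t z)]
  obtain ⟨n, rfl⟩ := hK
  induction n with
  | zero => simp
  | succ n ih =>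
    rw [show n + 1 + (n + 1) = n + n + 1 + 1 by ring, Finset.prod_range_succ,
      Finset.prod_range_succ, ih]
    simp [alt, Nat.even_add_one]

theorem chainPhase_const {K : ℕ} (hK : Even K) (ω : Ω) :
    chainPhase τ (Chain.const l r K ω) = 1 :=
  prod_alt_const hK (τ ω)

theorem chainPhase_step {K : ℕ} (hK : Even K) (hpos : 0 < K) {ω ω' : Ω} (h : r ω ω') :
    chainPhase τ (Chain.step (l := l) h K) = τ ω * (τ ω')⁻¹ := by
  have h1 := prod_alt_const hK (τ ω')
  obtain ⟨n, rfl⟩ : ∃ n, K = n + 1 := ⟨K - 1, by omega⟩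
  unfold chainPhase Chain.step
  rw [Fin.prod_univ_succ] at h1 ⊢
  have h2 := eq_inv_of_mul_eq_one_right h1
  simp only [Fin.val_succ, Nat.succ_ne_zero, if_false] at h2 ⊢
  rw [h2]
  simp [alt]

theorem exists_walk {ω ω' : Ω} (h : Relation.ReflTransGen (fun a b => l a b ∨ r a b) ω ω') :
    ∃ (q : ℕ → Ω) (N : ℕ), q 0 = ω ∧ (∀ t, linkRel l r t (q t) (q (t + 1))) ∧
      ∀ t, N ≤ t → q t = ω' := by
  induction h with
  | refl => exact ⟨fun _ => ω, 0, rfl, fun _ => Setoid.refl' _ _, fun _ _ => rfl⟩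
  | @tail b c _ hbc ih =>
    obtain ⟨q, N, h0, hl, hN⟩ := ih
    obtain ⟨T, hT, hlink⟩ : ∃ T, N ≤ T ∧ linkRel l r T b c := by
      rcases hbc with hbc | hbc
      · refine ⟨2 * N + 1, by omega, ?_⟩
        rw [linkRel, if_neg (by simp)]; exact hbc
      · refine ⟨2 * N, by omega, ?_⟩
        rw [linkRel, if_pos (by simp)]; exact hbc
    refine ⟨fun t => if t ≤ T then q t else c, T + 1, by simp [h0], fun t => ?_, fun t ht =>
      if_neg (by omega)⟩
    rcases lt_trichotomy t T with h | rfl | h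
    · simp only [if_pos h.le, if_pos (show t + 1 ≤ T from h)]; exact hl t
    · simp only [le_refl, if_true, if_neg (show ¬ t + 1 ≤ t by omega), hN t hT]; exact hlink
    · simp only [if_neg (show ¬ t ≤ T by omega), if_neg (show ¬ t + 1 ≤ T by omega)]
      exact Setoid.refl' _ _

/-- A single length suffices to join any two points by a chain. -/
theorem exists_walk_length [Finite Ω]
    (h : ∀ ω ω', Relation.ReflTransGen (fun a b => l a b ∨ r a b) ω ω') :
    ∃ k₀ : ℕ, ∀ k ≥ k₀, ∀ ω ω', ∃ q : ℕ → Ω, q 0 = ω ∧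
      (∀ t, linkRel l r t (q t) (q (t + 1))) ∧ ∀ t, k ≤ t → q t = ω' := by
  have := Fintype.ofFinite Ω
  choose q N h0 hl hN using fun x : Ω × Ω => exists_walk (h x.1 x.2)
  refine ⟨Finset.univ.sup N, fun k hk ω ω' => ⟨q (ω, ω'), h0 _, hl _, fun t ht =>
    hN _ t ((Finset.le_sup (Finset.mem_univ _)).trans (hk.trans ht))⟩⟩

end Walks

section ThreeBlocks

variable {Ω : Type*}

/-- The letters `c` of all points of a chain. -/
def allLetters {l r : Setoid Ω} (c : Setoid Ω) (K : ℕ) : Setoid (Chain l r K) :=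
  ⟨fun q q' => ∀ t, c (q.1 t) (q'.1 t), fun _ _ => c.refl _, fun h t => c.symm (h t),
    fun h h' t => c.trans (h t) (h' t)⟩

/-- The end block of a chain at the place `t`. -/
def placeBlock (l r : Setoid Ω) (K : ℕ) (t : Fin K) : Setoid (Chain l r K) :=
  l.comap fun q => q.1 t

/-- The first place of a chain. -/
def firstPlace (k : ℕ) : Fin (2 ^ (k + 1)) := ⟨0, by positivity⟩

/-- The last place of a chain. -/
def lastPlace (k : ℕ) : Fin (2 ^ (k + 1)) :=
  ⟨2 ^ (k + 1) - 1, Nat.sub_lt (by positivity) one_pos⟩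

theorem decays_of_chain_three [Fintype Ω] {l r c : Setoid Ω} {τ : Ω → Circle} (k : ℕ)
    (h : Decays (ends (placeBlock l r _ (firstPlace k)) (placeBlock l r _ (lastPlace k))
      fun _ : Unit => allLetters c _) (chainPhase τ)) :
    Decays (ends l r fun _ : Unit => c) τ := by
  apply decays_of_chain k
  refine h.of_map id (fun i => match i with
    | .inl b => .inl b
    | .inr x => .inr x.2) (fun _ => rfl) ?_
  rintro ((_ | _) | ⟨t, i⟩) q q' h
  · intro t ht
    rw [show t = firstPlace k from Fin.ext ht]; exact h
  · intro t ht
    rw [show t = lastPlace k from Fin.ext (by simp only [lastPlace]; omega)]; exact h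
  · exact h t

theorem decays_ends_swap [Fintype Ω] {l r c : Setoid Ω} {τ : Ω → Circle}
    (h : Decays (ends l r fun _ : Unit => c) τ) : Decays (ends l c fun _ : Unit => r) τ := by
  refine h.of_map id (fun i => match i with
    | .inl false => .inl false
    | .inl true => .inr ()
    | .inr _ => .inl true) (fun _ => rfl) ?_
  rintro ((_ | _) | i) q q' h <;> exact h

variable (A B C : Setoid Ω) (k₁ k₂ : ℕ)

/-- Chains linked by `A` and `B`. -/
abbrev FirstChain : Type _ := Chain A B (2 ^ (k₁ + 1))

/-- Chains of chains linked by their first `A`-class and all their `C`-classes. -/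
abbrev SecondChain : Type _ :=
  Chain (placeBlock A B _ (firstPlace k₁)) (allLetters (l := A) (r := B) C (2 ^ (k₁ + 1)))
    (2 ^ (k₂ + 1))

/-- The last `A`-classes of all chains of a chain of chains. -/
def lastClasses : Setoid (SecondChain A B C k₁ k₂) :=
  allLetters (placeBlock A B _ (lastPlace k₁)) _

/-- Pairs of chains of chains that agree in all last `A`-classes. -/
def QuadGame : Type _ :=
  {x : SecondChain A B C k₁ k₂ × SecondChain A B C k₁ k₂ // lastClasses A B C k₁ k₂ x.1 x.2}

noncomputable instance [Fintype Ω] : Fintype (QuadGame A B C k₁ k₂) :=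
  open Classical in inferInstanceAs (Fintype (Subtype _))

/-- The `A`-class of the first point of the chain at place `t`. -/
def chainLabel {A B C : Setoid Ω} {k₁ k₂ : ℕ} (t : Fin (2 ^ (k₂ + 1)))
    (x : SecondChain A B C k₁ k₂) : Quotient A :=
  Quotient.mk A ((x.1 t).1 (firstPlace k₁))

theorem rel_of_chainLabel_eq {A B C : Setoid Ω} {k₁ k₂ : ℕ} {t : Fin (2 ^ (k₂ + 1))}
    {x y : SecondChain A B C k₁ k₂} (h : chainLabel t x = chainLabel t y) :
    placeBlock (placeBlock A B _ (firstPlace k₁)) (allLetters C _) _ t x y :=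
  Quotient.exact (s := A) (a := (x.1 t).1 (firstPlace k₁)) (b := (y.1 t).1 (firstPlace k₁)) h

/-- The phase of a pair of chains of chains. -/
noncomputable def quadPhase {A B C : Setoid Ω} {k₁ k₂ : ℕ} (τ : Ω → Circle)
    (x : QuadGame A B C k₁ k₂) : Circle :=
  chainPhase (chainPhase τ) x.1.1 * (chainPhase (chainPhase τ) x.1.2)⁻¹

theorem decays_of_quadGame [Fintype Ω] {A B C : Setoid Ω} {k₁ k₂ : ℕ} {τ : Ω → Circle}
    (h : Decays (ends (Setoid.ker fun x : QuadGame A B C k₁ k₂ => chainLabel (firstPlace k₂) x.1.1)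
      (Setoid.ker fun x => chainLabel (firstPlace k₂) x.1.2)
      fun b : Bool => Setoid.ker (if b then fun x => chainLabel (lastPlace k₂) x.1.2
        else fun x => chainLabel (lastPlace k₂) x.1.1)) (quadPhase τ)) :
    Decays (ends A B fun _ : Unit => C) τ := by
  apply decays_of_chain_three k₁
  apply decays_ends_swap
  apply decays_of_chain_three k₂
  refine decays_of_double h (fun i => i = .inr ()) (fun x => x.1.1) (fun x => x.1.2) ?_
    (fun _ => rfl)
    (fun i _ => match i with
      | .inl false => .inl false
      | .inl true => .inr false
      | .inr _ => .inl false)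
    (fun i _ => match i with
      | .inl false => .inl true
      | .inl true => .inr true
      | .inr _ => .inl false) ?_ ?_
  · rintro _ rfl x
    exact x.2
  · rintro ((_ | _) | i) hi x y h
    · exact rel_of_chainLabel_eq h
    · exact rel_of_chainLabel_eq h
    · exact absurd rfl hi
  · rintro ((_ | _) | i) hi x y h
    · exact rel_of_chainLabel_eq h
    · exact rel_of_chainLabel_eq h
    · exact absurd rfl hi

/-- In a game with three blocks, if the blocks `A`, `B` and the blocks `A`, `C` connect all points
and there is no decay, then the phase of a `B`-`C`-rectangle is determined by the `A`-classes. -/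
theorem exists_rectangle_potential [Fintype Ω] {A B C : Setoid Ω} {τ : Ω → Circle}
    (hAB : ∀ ω ω', Relation.ReflTransGen (fun a b => A a b ∨ B a b) ω ω')
    (hAC : ∀ ω ω', Relation.ReflTransGen (fun a b => A a b ∨ C a b) ω ω')
    (h : ¬ Decays (ends A B fun _ : Unit => C) τ) :
    ∃ φ : Ω → Circle, (∀ ω ω', A ω ω' → φ ω = φ ω') ∧
      ∀ ω₁₁ ω₁₂ ω₂₁ ω₂₂, B ω₁₁ ω₁₂ → B ω₂₁ ω₂₂ → C ω₁₁ ω₂₁ → C ω₁₂ ω₂₂ →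
        τ ω₁₁ * (τ ω₁₂)⁻¹ * (τ ω₂₁ * (τ ω₂₂)⁻¹)⁻¹ =
          φ ω₁₁ * (φ ω₂₁)⁻¹ * φ ω₂₂ * (φ ω₁₂)⁻¹ := by
  obtain ⟨k₁, hk₁⟩ := exists_walk_length hAB
  obtain ⟨k₂, hk₂⟩ := exists_walk_length hAC
  have hle : ∀ k, k ≤ 2 ^ (k + 1) - 1 := fun k => by
    have : k + 1 < 2 ^ (k + 1) := Nat.lt_two_pow_self
    omega
  have hev : ∀ k, Even (2 ^ (k + 1)) := fun k => even_two.pow_of_ne_zero (by omega)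
  have hpos : ∀ k, 0 < 2 ^ (k + 1) := fun k => by positivity
  have key := exists_potential (Q := QuadGame A B C k₁ k₂)
    (a1 := fun x => chainLabel (firstPlace k₂) x.1.1)
    (a2 := fun x => chainLabel (lastPlace k₂) x.1.1)
    (a3 := fun x => chainLabel (lastPlace k₂) x.1.2)
    (a4 := fun x => chainLabel (firstPlace k₂) x.1.2) (τ := quadPhase τ) ?_ ?_
    fun hD => h (decays_of_quadGame hD)
  · obtain ⟨φ, hφ⟩ := key
    refine ⟨fun ω => φ (Quotient.mk A ω), fun ω ω' hω => congrArg φ (Quotient.sound hω), ?_⟩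
    intro ω₁₁ ω₁₂ ω₂₁ ω₂₂ hB₁ hB₂ hC₁ hC₂
    let κ₁ : FirstChain A B k₁ := Chain.step hB₁ _
    let κ₂ : FirstChain A B k₁ := Chain.step hB₂ _
    have hκ : allLetters C _ κ₁ κ₂ := fun t => by
      show C (if t.1 = 0 then ω₁₁ else ω₁₂) (if t.1 = 0 then ω₂₁ else ω₂₂)
      split_ifs
      · exact hC₁
      · exact hC₂
    have hconst : allLetters (l := A) (r := B) C (2 ^ (k₁ + 1)) (Chain.const _ _ _ ω₁₂)
        (Chain.const _ _ _ ω₂₂) := fun t => hC₂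
    have hlast : (lastPlace k₁).1 ≠ 0 := by
      have : 1 < 2 ^ (k₁ + 1) := Nat.one_lt_two_pow (by omega)
      simp only [lastPlace]; omega
    have hlast₂ : (lastPlace k₂).1 ≠ 0 := by
      have : 1 < 2 ^ (k₂ + 1) := Nat.one_lt_two_pow (by omega)
      simp only [lastPlace]; omega
    have hlast₃ : lastPlace k₂ ≠ 0 := fun h => hlast₂ (by rw [h]; rfl)
    have := hφ ⟨(Chain.step hκ _, Chain.step hconst _), fun t => by
      show A ((if t.1 = 0 then κ₁ else κ₂).1 (lastPlace k₁))
        ((if t.1 = 0 then Chain.const A B _ ω₁₂ else Chain.const A B _ ω₂₂).1 (lastPlace k₁))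
      split_ifs
      · show A (if (lastPlace k₁).1 = 0 then ω₁₁ else ω₁₂) ω₁₂
        rw [if_neg hlast]
      · show A (if (lastPlace k₁).1 = 0 then ω₂₁ else ω₂₂) ω₂₂
        rw [if_neg hlast]⟩
    change chainPhase (chainPhase τ) (Chain.step hκ _) *
      (chainPhase (chainPhase τ) (Chain.step hconst _))⁻¹ = _ at this
    rw [chainPhase_step (hev _) (hpos _), chainPhase_step (hev _) (hpos _),
      chainPhase_step (hev _) (hpos _), chainPhase_step (hev _) (hpos _),
      chainPhase_const (hev _), chainPhase_const (hev _)] at this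
    simpa [chainLabel, Chain.step, Chain.const, hlast₃, κ₁, κ₂, firstPlace] using this
  · intro x y
    obtain ⟨a, rfl⟩ := Quotient.exists_rep x
    obtain ⟨b, rfl⟩ := Quotient.exists_rep y
    obtain ⟨p, hp0, hpl, hpK⟩ := hk₁ k₁ le_rfl a a
    obtain ⟨q, hq0, hql, hqK⟩ := hk₁ k₁ le_rfl b a
    refine ⟨⟨(Chain.const _ _ _ (Chain.ofSeq p hpl _), Chain.const _ _ _ (Chain.ofSeq q hql _)),
      fun t => ?_⟩, ?_, ?_, ?_, ?_, ?_⟩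
    · show A (p (2 ^ (k₁ + 1) - 1)) (q (2 ^ (k₁ + 1) - 1))
      rw [hpK _ (hle _), hqK _ (hle _)]
    · exact congrArg (Quotient.mk A) hp0
    · exact congrArg (Quotient.mk A) hp0
    · exact congrArg (Quotient.mk A) hq0
    · exact congrArg (Quotient.mk A) hq0
    · show chainPhase (chainPhase τ) _ * (chainPhase (chainPhase τ) _)⁻¹ = 1
      rw [chainPhase_const (hev _), chainPhase_const (hev _)]
      simp
  · intro x y
    obtain ⟨a, rfl⟩ := Quotient.exists_rep x
    obtain ⟨b, rfl⟩ := Quotient.exists_rep y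
    obtain ⟨p, hp0, hpl, hpK⟩ := hk₂ k₂ le_rfl a b
    let lam : SecondChain A B C k₁ k₂ := Chain.ofSeq (fun t => Chain.const A B _ (p t)) (fun t => by
      have := hpl t
      by_cases ht : Even t
      · rw [linkRel, if_pos ht] at this ⊢
        exact fun _ => this
      · rw [linkRel, if_neg ht] at this ⊢
        exact this) _
    refine ⟨⟨(lam, lam), Setoid.refl' _ _⟩, ?_, ?_, ?_, ?_, ?_⟩
    · exact congrArg (Quotient.mk A) hp0
    · exact congrArg (Quotient.mk A) (hpK _ (hle _))
    · exact congrArg (Quotient.mk A) (hpK _ (hle _))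
    · exact congrArg (Quotient.mk A) hp0
    · exact mul_inv_cancel _

end ThreeBlocks

section Embedding

variable {S : Type*} {l r : Setoid S} {τ : S → Circle}

/-- The chain `ω, …, ω, ω'`. -/
def Chain.stepLast {ω ω' : S} (h : r ω ω') {K : ℕ} (hK : Even K) : Chain l r K :=
  ⟨fun t => if t.1 + 1 = K then ω' else ω, fun s t hst => by
    show linkRel l r s.1 (if s.1 + 1 = K then ω' else ω) (if t.1 + 1 = K then ω' else ω)
    rw [if_neg (show ¬ s.1 + 1 = K by omega)]
    split_ifs with h0
    · rw [linkRel, if_pos]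
      · exact h
      · rw [← h0, ← hst] at hK
        simpa [Nat.even_add_one] using hK
    · exact Setoid.refl' _ _⟩

theorem chainPhase_stepLast {ω ω' : S} (h : r ω ω') {K : ℕ} (hK : Even K) (hpos : 0 < K) :
    chainPhase τ (Chain.stepLast (l := l) h hK) = τ ω * (τ ω')⁻¹ := by
  have h1 := prod_alt_const hK (τ ω)
  obtain ⟨n, rfl⟩ : ∃ n, K = n + 1 := ⟨K - 1, by omega⟩
  have hn : ¬ Even n := by rwa [Nat.even_add_one] at hK
  unfold chainPhase Chain.stepLast
  rw [Fin.prod_univ_castSucc] at h1 ⊢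
  have h2 := eq_inv_of_mul_eq_one_left h1
  have h3 : ∀ i : Fin n, ¬ (i.1 + 1 = n + 1) := fun i => by have := i.2; omega
  simp only [Fin.val_castSucc, Fin.val_last, h3, if_true, if_false] at h2 ⊢
  rw [h2]
  simp [alt, hn]

/-- The block of the letters `rx` of all points of a chain but the last. -/
def initBlock (rx l r : Setoid S) (K : ℕ) : Setoid (Chain l r K) :=
  ⟨fun q q' => ∀ t : Fin K, t.1 + 1 < K → rx (q.1 t) (q'.1 t), fun _ _ _ => rx.refl _,
    fun h t ht => rx.symm (h t ht), fun h h' t ht => rx.trans (h t ht) (h' t ht)⟩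

/-- The block of the last point of a chain. -/
def finalBlock (rx l r : Setoid S) (k : ℕ) : Setoid (Chain l r (2 ^ (k + 1))) :=
  (rx ⊓ l).comap fun q => q.1 (lastPlace k)

theorem decays_of_chain_init [Fintype S] {rx : Setoid S} (k : ℕ)
    (h : Decays (ends (initBlock rx l r _) (placeBlock l r _ (firstPlace k))
      fun _ : Unit => finalBlock rx l r k) (chainPhase τ)) :
    Decays (ends l r fun _ : Unit => rx) τ := by
  apply decays_of_chain k
  refine h.of_map id (fun i => match i with
    | .inl false => .inl true
    | .inl true => .inr ()
    | .inr (t, _) => if t.1 + 1 < 2 ^ (k + 1) then .inl false else .inr ()) (fun _ => rfl) ?_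
  have hlast : ∀ t : Fin (2 ^ (k + 1)), ¬ t.1 + 1 < 2 ^ (k + 1) → t = lastPlace k := fun t ht =>
    Fin.ext (by simp only [lastPlace]; omega)
  rintro ((_ | _) | ⟨t, i⟩) q q' h
  · intro t ht
    rw [show t = firstPlace k from Fin.ext ht]; exact h
  · intro t ht
    rw [hlast t (by omega)]; exact h.2
  · change (ends (initBlock rx l r _) (placeBlock l r _ (firstPlace k))
      (fun _ : Unit => finalBlock rx l r k))
      (if t.1 + 1 < 2 ^ (k + 1) then .inl false else .inr ()) q q' at h
    by_cases ht : t.1 + 1 < 2 ^ (k + 1)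
    · rw [if_pos ht] at h
      exact h t ht
    · rw [if_neg ht] at h
      rw [hlast t ht]; exact h.1

/-- If any two of the three blocks connect all points and there is no decay, then the phase is a
product of functions of the blocks. -/
theorem exists_embedding_of_not_decays [Fintype S] {rx ry rz : Setoid S}
    (hxy : ∀ s s', Relation.ReflTransGen (fun p q => rx p q ∨ ry p q) s s')
    (hyz : ∀ s s', Relation.ReflTransGen (fun p q => ry p q ∨ rz p q) s s')
    (hxz : ∀ s s', Relation.ReflTransGen (fun p q => rx p q ∨ rz p q) s s')
    (h : ¬ Decays (ends ry rz fun _ : Unit => rx) τ) :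
    ∃ a b c : S → Circle, (∀ s s', rx s s' → a s = a s') ∧ (∀ s s', ry s s' → b s = b s') ∧
      (∀ s s', rz s s' → c s = c s') ∧ ∀ s, τ s = a s * b s * c s := by
  rcases isEmpty_or_nonempty S with hS | ⟨⟨s₀⟩⟩
  · exact ⟨isEmptyElim, isEmptyElim, isEmptyElim, isEmptyElim, isEmptyElim, isEmptyElim,
      isEmptyElim⟩
  obtain ⟨k, hk⟩ := exists_walk_length hyz
  have hle : k ≤ 2 ^ (k + 1) - 1 := by
    have : k + 1 < 2 ^ (k + 1) := Nat.lt_two_pow_self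
    omega
  have hev : Even (2 ^ (k + 1)) := even_two.pow_of_ne_zero (by omega)
  have hpos : 0 < 2 ^ (k + 1) := by positivity
  have htwo : 1 < 2 ^ (k + 1) := Nat.one_lt_two_pow (by omega)
  set K := 2 ^ (k + 1) with hK
  have hwalk : ∀ p p', ∃ q : Chain ry rz K, q.1 (firstPlace k) = p ∧ q.1 (lastPlace k) = p' := by
    intro p p'
    obtain ⟨q, h0, hl, hN⟩ := hk k le_rfl p p'
    exact ⟨Chain.ofSeq q hl _, h0, hN _ hle⟩
  let A : Setoid (Chain ry rz K) := initBlock rx ry rz K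
  let B : Setoid (Chain ry rz K) := placeBlock ry rz K (firstPlace k)
  let C : Setoid (Chain ry rz K) := finalBlock rx ry rz k
  let cst : S → Chain ry rz K := Chain.const ry rz K
  have hAx : ∀ p p', rx p p' → A (cst p) (cst p') := fun p p' h _ _ => h
  have hAl : ∀ {p p'} (h : rz p p'), A (cst p) (Chain.stepLast h hev) := fun {p p'} h t ht => by
    show rx p (if t.1 + 1 = K then p' else p)
    rw [if_neg ht.ne]
  have hCl : ∀ {p p'} (h : rz p p'), C (Chain.stepLast h hev) (cst p') := fun {p p'} h => by
    have : (lastPlace k).1 + 1 = K := by simp only [lastPlace]; omega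
    show (rx ⊓ ry) (if (lastPlace k).1 + 1 = K then p' else p) p'
    rw [if_pos this]
  have hAB : ∀ ω ω', Relation.ReflTransGen (fun a b => A a b ∨ B a b) ω ω' := by
    intro ω ω'
    have h1 : ∀ ω : Chain ry rz K, B ω (cst (ω.1 (firstPlace k))) := fun ω => ry.refl _
    refine .head (.inr (h1 ω)) (.tail ?_ (.inr (B.symm (h1 ω'))))
    refine (hxy _ _).lift cst fun p p' hp => ?_
    exact hp.imp (hAx p p') id
  have hAC : ∀ ω ω', Relation.ReflTransGen (fun a b => A a b ∨ C a b) ω ω' := by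
    intro ω ω'
    have h1 : ∀ ω : Chain ry rz K, C ω (cst (ω.1 (lastPlace k))) := fun ω =>
      (rx ⊓ ry).refl _
    refine .head (.inr (h1 ω)) (.tail ?_ (.inr (C.symm (h1 ω'))))
    refine (hxz _ _).lift' cst fun p p' hp => ?_
    rcases hp with hp | hp
    · exact .single (.inl (hAx p p' hp))
    · exact .head (.inl (hAl hp)) (.single (.inr (hCl hp)))
  obtain ⟨φ, hφA, hφ⟩ := exists_rectangle_potential hAB hAC fun hD => h (decays_of_chain_init k hD)
  choose W hW0 hW1 using fun p : S × S => hwalk p.1 p.2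
  let ny : S → S := fun s => (Quotient.mk ry s).out
  let nz : S → S := fun s => (Quotient.mk rz s).out
  have hny : ∀ s, ry s (ny s) := fun s => ry.symm (Quotient.mk_out (s := ry) s)
  have hnz : ∀ s, rz s (nz s) := fun s => rz.symm (Quotient.mk_out (s := rz) s)
  have hny' : ∀ s s', ry s s' → ny s = ny s' := fun s s' hs =>
    congrArg Quotient.out (Quotient.sound (s := ry) hs)
  have hnz' : ∀ s s', rz s s' → nz s = nz s' := fun s s' hs =>
    congrArg Quotient.out (Quotient.sound (s := rz) hs)
  let T : Chain ry rz K → Circle := chainPhase τ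
  refine ⟨fun s => φ (cst s),
    fun s => T (W (ny s, s₀)) * (φ (W (ny s, s₀)))⁻¹,
    fun s => τ (nz s) * T (W (s₀, nz s)) * (T (W (s₀, s₀)))⁻¹ * φ (W (s₀, s₀)) *
      (φ (W (s₀, nz s)))⁻¹,
    fun s s' hs => hφA _ _ (hAx _ _ hs), fun s s' hs => by simp only [hny' s s' hs],
    fun s s' hs => by simp only [hnz' s s' hs], fun s => ?_⟩
  have hrect := hφ (Chain.stepLast (hnz s) hev) (W (ny s, s₀)) (W (s₀, nz s)) (W (s₀, s₀))
    (by
      show ry (if (firstPlace k).1 + 1 = K then nz s else s) ((W (ny s, s₀)).1 (firstPlace k))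
      rw [hW0, if_neg (by simp only [firstPlace]; omega)]
      exact hny s)
    (by
      show ry ((W _).1 (firstPlace k)) ((W _).1 (firstPlace k))
      rw [hW0, hW0])
    (by
      show (rx ⊓ ry) (if (lastPlace k).1 + 1 = K then nz s else s) ((W (s₀, nz s)).1 (lastPlace k))
      rw [hW1, if_pos (by simp only [lastPlace]; omega)])
    (by
      show (rx ⊓ ry) ((W _).1 (lastPlace k)) ((W _).1 (lastPlace k))
      rw [hW1, hW1])
  rw [chainPhase_stepLast _ _ hpos, ← hφA _ _ (hAl (hnz s))] at hrect
  have hcomm : ∀ t n w v u f e d g : Additive Circle,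
      t + -n + -w + -(v + -u) = f + -e + d + -g →
        t = f + (w + -g) + (n + v + -u + d + -e) := by
    intro t n w v u f e d g h
    have : t = (t + -n + -w + -(v + -u)) + (n + w + (v + -u)) := by abel
    rw [this, h]
    abel
  exact hcomm _ _ _ _ _ _ _ _ _ hrect

end Embedding

theorem reflTransGen_of_connected {U V S : Type*} {R : U → V → Prop} (u : S → U) (v : S → V)
    (hR : ∀ a b, R a b → ∃ s, u s = a ∧ v s = b)
    (h : (relBipartiteGraph R).Connected) (s s' : S) :
    Relation.ReflTransGen (fun p q => Setoid.ker u p q ∨ Setoid.ker v p q) s s' := by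
  have hreach := h.preconnected (.inl (u s)) (.inl (u s'))
  rw [SimpleGraph.reachable_iff_reflTransGen] at hreach
  have key : ∀ b : U ⊕ V, Relation.ReflTransGen (relBipartiteGraph R).Adj (.inl (u s)) b →
      ∀ s', (b = .inl (u s') ∨ b = .inr (v s')) →
        Relation.ReflTransGen (fun p q => Setoid.ker u p q ∨ Setoid.ker v p q) s s' := by
    intro b hb
    induction hb with
    | refl =>
      rintro s' (h | h)
      · exact .single (.inl (Sum.inl_injective h))
      · cases h
    | tail _ hadj ih =>
      intro s' hs'
      rw [relBipartiteGraph, SimpleGraph.fromRel_adj] at hadj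
      obtain ⟨-, ⟨a, b, rfl, rfl, hab⟩ | ⟨a, b, rfl, rfl, hab⟩⟩ := hadj
      · obtain ⟨s'', rfl, rfl⟩ := hR a b hab
        refine (ih s'' (.inl rfl)).tail ?_
        rcases hs' with h | h
        · cases h
        · exact .inr (Sum.inr_injective h)
      · obtain ⟨s'', rfl, rfl⟩ := hR a b hab
        refine (ih s'' (.inr rfl)).tail ?_
        rcases hs' with h | h
        · exact .inl (Sum.inl_injective h)
        · cases h
  exact key _ hreach s' (.inl rfl)

/-- A function to the circle that factors through `w` gives, inverted, a function to the disk on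
the target of `w`. -/
theorem exists_disk_extension {S W : Type*} (w : S → W) (f : S → Circle)
    (hf : ∀ p p', w p = w p' → f p = f p') :
    ∃ F : W → ℂ, (∀ x, F x ∈ Metric.closedBall (0 : ℂ) 1) ∧ ∀ p, F (w p) = (f p : ℂ)⁻¹ := by
  classical
  have : ∀ x, ∃ z : ℂ, z ∈ Metric.closedBall (0 : ℂ) 1 ∧ ∀ p, w p = x → z = (f p : ℂ)⁻¹ := by
    intro x
    by_cases h : ∃ p, w p = x
    · obtain ⟨p, rfl⟩ := h
      refine ⟨(f p : ℂ)⁻¹, ?_, fun p' hp' => by rw [hf p' p hp']⟩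
      rw [mem_closedBall_zero_iff, norm_inv, Circle.norm_coe, inv_one]
    · exact ⟨0, by simp, fun p hp => absurd ⟨p, hp⟩ h⟩
  choose F hF hF' using this
  exact ⟨F, hF, fun p => hF' _ p rfl⟩

namespace XORGame

section

variable {m : ℕ} [NeZero m]

theorem sum_freq (u : ZMod m) : ∑ s : ZMod m, (1 / (m : ℂ)) * (ZMod.toCircle (s * u) : ℂ) =
    if u = 0 then 1 else 0 := by
  have hm : (m : ℂ) ≠ 0 := by exact_mod_cast NeZero.ne m
  rw [← Finset.mul_sum]
  have := AddChar.sum_mulShift u (ZMod.isPrimitive_stdAddChar m)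
  simp only [ZMod.stdAddChar_apply, ZMod.card] at this
  rw [this]
  split_ifs <;> simp [hm]

variable {X Y Z : Type*} (G : XORGame X Y Z (ZMod m))

/-- The phase of a game as a point of the circle. -/
noncomputable def circlePhase (p : G.dist.support) : Circle := ZMod.toCircle (G.target p)

theorem coe_circlePhase (p : G.dist.support) : (G.circlePhase p : ℂ) = G.phase p := by
  rw [circlePhase, ZMod.toCircle_apply, phase, ← Complex.exp_nat_mul]
  congr 1
  ring

/-- The function of a player in the correlation of frequencies. -/
noncomputable def freqFun {W : Type*} {n : ℕ} (w : G.dist.support → W)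
    (f : (Fin n → W) → Fin n → ZMod m) (q : Fin n → ZMod m × G.dist.support) : ℂ :=
  ∏ i, (ZMod.toCircle (-((q i).1 * f (fun j => w (q j).2) i)) : ℂ)

theorem norm_freqFun_le {W : Type*} {n : ℕ} (w : G.dist.support → W)
    (f : (Fin n → W) → Fin n → ZMod m) (q : Fin n → ZMod m × G.dist.support) :
    ‖G.freqFun w f q‖ ≤ 1 := by
  rw [freqFun, norm_prod]
  exact Finset.prod_le_one (fun _ _ => norm_nonneg _) fun _ _ => (Circle.norm_coe _).le

theorem freqFun_congr {W : Type*} {n : ℕ} (w : G.dist.support → W)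
    (f : (Fin n → W) → Fin n → ZMod m) (q q' : Fin n → ZMod m × G.dist.support)
    (hq : ∀ k, ((q k).1, w (q k).2) = ((q' k).1, w (q' k).2)) :
    G.freqFun w f q = G.freqFun w f q' := by
  have h1 : ∀ k, (q k).1 = (q' k).1 := fun k => (Prod.ext_iff.1 (hq k)).1
  have h2 : ∀ k, w (q k).2 = w (q' k).2 := fun k => (Prod.ext_iff.1 (hq k)).2
  simp only [freqFun, h1, h2]

end

section

variable {X Y Z : Type*} [Fintype X] [Fintype Y] [Fintype Z] {m : ℕ} (G : XORGame X Y Z (ZMod m))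

noncomputable instance : Fintype G.dist.support :=
  open Classical in inferInstance

theorem sum_support_toReal : ∑ p : G.dist.support, (G.dist p.1).toReal = 1 := by
  have h1 : ∑ p, (G.dist p).toReal = 1 := by
    rw [← ENNReal.toReal_sum fun p _ => G.dist.apply_ne_top p, ← tsum_fintype (L := .unconditional _),
      G.dist.tsum_coe, ENNReal.toReal_one]
  rw [← h1]
  refine Fintype.sum_of_injective _ Subtype.val_injective _ _ (fun p hp => ?_) fun _ => rfl
  rw [Subtype.range_coe, PMF.mem_support_iff, not_not] at hp
  rw [hp, ENNReal.toReal_zero]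

theorem winProb_eq_sum (n : ℕ) (f : (Fin n → X) → Fin n → ZMod m)
    (g : (Fin n → Y) → Fin n → ZMod m) (h : (Fin n → Z) → Fin n → ZMod m) :
    G.winProb n f g h = ∑ q : Fin n → G.dist.support, ∏ i, ((G.dist (q i).1).toReal *
      if G.target (q i) - f (fun j => (q j).1.1) i - g (fun j => (q j).1.2.1) i -
        h (fun j => (q j).1.2.2) i = 0 then 1 else 0) := by
  classical
  unfold winProb
  rw [PMF.toOuterMeasure_apply_fintype, ENNReal.toReal_sum]
  · symm
    refine Fintype.sum_of_injective (fun (q : Fin n → G.dist.support) i => (q i).1)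
      (fun q q' hq => funext fun i => Subtype.ext (congrFun hq i)) _ _ (fun q hq => ?_) fun q => ?_
    · rw [Set.indicator_of_notMem, ENNReal.toReal_zero]
      intro hw
      exact hq ⟨fun i => ⟨q i, (hw i).1⟩, rfl⟩
    · rw [Finset.prod_mul_distrib, Finset.prod_boole]
      by_cases hw : (fun i => (q i).1) ∈ G.winEvent n f g h
      · rw [Set.indicator_of_mem hw, if_pos, mul_one]
        · exact (ENNReal.toReal_prod _ _).symm
        · intro i _
          obtain ⟨_, hi⟩ := hw i
          rw [← hi]; ring
      · rw [Set.indicator_of_notMem hw, if_neg, mul_zero, ENNReal.toReal_zero]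
        intro hall
        refine hw fun i => ⟨(q i).2, ?_⟩
        have := hall i (Finset.mem_univ i)
        linear_combination -this
  · intro q _
    refine ne_top_of_le_ne_top (PMF.apply_ne_top (G.dist.prodPow n) q) (Set.indicator_le_self _ _ q)

end

variable {X Y Z : Type*} [Fintype X] [Fintype Y] [Fintype Z] {m : ℕ} [NeZero m]
  (G : XORGame X Y Z (ZMod m))

/-- The blocks of the three players on the support of a game. -/
def blocks : Bool ⊕ Unit → Setoid G.dist.support :=
  ends (Setoid.ker fun p => p.1.2.1) (Setoid.ker fun p => p.1.2.2)
    fun _ : Unit => Setoid.ker fun p => p.1.1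

theorem decays_of_nonembeddable (hconn : PairwiseConnected G.dist)
    (hT : Nonembeddable G.dist G.phase) : Decays G.blocks G.circlePhase := by
  classical
  by_contra h
  obtain ⟨hxy, hyz, hxz⟩ := hconn
  obtain ⟨a, b, c, ha, hb, hc, habc⟩ := exists_embedding_of_not_decays
    (reflTransGen_of_connected (fun p : G.dist.support => p.1.1) (fun p => p.1.2.1)
      (fun x y ⟨z, hz⟩ => ⟨⟨_, hz⟩, rfl, rfl⟩) hxy)
    (reflTransGen_of_connected (fun p : G.dist.support => p.1.2.1) (fun p => p.1.2.2)
      (fun y z ⟨x, hx⟩ => ⟨⟨_, hx⟩, rfl, rfl⟩) hyz)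
    (reflTransGen_of_connected (fun p : G.dist.support => p.1.1) (fun p => p.1.2.2)
      (fun x z ⟨y, hy⟩ => ⟨⟨_, hy⟩, rfl, rfl⟩) hxz) h
  obtain ⟨A, hA, hA'⟩ := exists_disk_extension (fun p : G.dist.support => p.1.1) a fun p p' h => ha p p' h
  obtain ⟨B, hB, hB'⟩ := exists_disk_extension (fun p : G.dist.support => p.1.2.1) b fun p p' h => hb p p' h
  obtain ⟨C, hC, hC'⟩ := exists_disk_extension (fun p : G.dist.support => p.1.2.2) c fun p p' h => hc p p' h
  refine hT ⟨A, B, C, hA, hB, hC, fun p => ?_⟩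
  rw [← coe_circlePhase, habc, hA', hB', hC']
  have h1 := Circle.coe_ne_zero (a p)
  have h2 := Circle.coe_ne_zero (b p)
  have h3 := Circle.coe_ne_zero (c p)
  push_cast
  field_simp

/-- The weights of the points of the support, with a uniform frequency. -/
noncomputable def freqWeight (ω : ZMod m × G.dist.support) : ℝ :=
  (G.dist ω.2.1).toReal / m

/-- The phase at a frequency. -/
noncomputable def freqPhase (ω : ZMod m × G.dist.support) : Circle :=
  ZMod.toCircle (ω.1 * G.target ω.2)

/-- The blocks of the three players, with the frequency known to all. -/
def freqBlocks : Bool ⊕ Unit → Setoid (ZMod m × G.dist.support) :=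
  ends (Setoid.ker fun p => (p.1, p.2.1.2.1)) (Setoid.ker fun p => (p.1, p.2.1.2.2))
    fun _ : Unit => Setoid.ker fun p => (p.1, p.2.1.1)

theorem decayBound_freq (hconn : PairwiseConnected G.dist) (hT : Nonembeddable G.dist G.phase) :
    ∃ ρ, 0 ≤ ρ ∧ ρ < 1 ∧ DecayBound G.freqBlocks G.freqPhase G.freqWeight ρ := by
  have hm : (0 : ℝ) < m := by exact_mod_cast NeZero.pos m
  refine (G.decays_of_nonembeddable hconn hT).decayBound_of_map (fun p => (1, p)) id
    (fun p => by simp [freqPhase, circlePhase]) ?_ _ (fun ω => ?_) (fun p => ?_) ?_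
  · rintro ((_ | _) | i) p p' h <;> exact congrArg (Prod.mk 1) h
  · exact div_nonneg ENNReal.toReal_nonneg hm.le
  · exact div_pos (ENNReal.toReal_pos p.2 (G.dist.apply_ne_top _)) hm
  · rw [Fintype.sum_prod_type]
    simp only [freqWeight, ← Finset.sum_div, sum_support_toReal]
    simp [hm.ne']

theorem winProb_eq_corr (n : ℕ) (f : (Fin n → X) → Fin n → ZMod m)
    (g : (Fin n → Y) → Fin n → ZMod m) (h : (Fin n → Z) → Fin n → ZMod m) :
    (G.winProb n f g h : ℂ) = corr G.freqWeight G.freqPhase fun i : Bool ⊕ Unit => match i with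
      | .inl false => G.freqFun (fun p => p.1.2.1) g
      | .inl true => G.freqFun (fun p => p.1.2.2) h
      | .inr _ => G.freqFun (fun p => p.1.1) f := by
  rw [winProb_eq_sum, corr]
  rw [← (Equiv.arrowProdEquivProdArrow (Fin n) (fun _ => ZMod m)
    (fun _ => G.dist.support)).symm.sum_comp, Fintype.sum_prod_type_right]
  rw [Complex.ofReal_sum]
  refine Finset.sum_congr rfl fun q _ => ?_
  rw [Complex.ofReal_prod]
  refine (Finset.prod_congr rfl fun i _ => ?_).trans ((Fintype.prod_sum fun i (s : ZMod m) =>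
    ((G.dist (q i).1).toReal : ℂ) * ((1 / (m : ℂ)) *
      (ZMod.toCircle (s * (G.target (q i) - f (fun j => (q j).1.1) i -
        g (fun j => (q j).1.2.1) i - h (fun j => (q j).1.2.2) i)) : ℂ))).trans ?_)
  · rw [← Finset.mul_sum, sum_freq, Complex.ofReal_mul]
    split_ifs <;> simp
  refine Finset.sum_congr rfl fun s _ => ?_
  rw [Fintype.prod_sum_type, Fintype.prod_bool, Fintype.prod_unique (fun _ : Unit => _),
    Complex.ofReal_prod]
  change _ = (∏ i, (((G.dist (q i).1).toReal / m : ℝ) : ℂ)) *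
    ((∏ i, (ZMod.toCircle (s i * G.target (q i)) : ℂ)) *
      ((∏ i, (ZMod.toCircle (-(s i * h (fun j => (q j).1.2.2) i)) : ℂ)) *
        (∏ i, (ZMod.toCircle (-(s i * g (fun j => (q j).1.2.1) i)) : ℂ)) *
          ∏ i, (ZMod.toCircle (-(s i * f (fun j => (q j).1.1) i)) : ℂ)))
  rw [← Finset.prod_mul_distrib, ← Finset.prod_mul_distrib, ← Finset.prod_mul_distrib,
    ← Finset.prod_mul_distrib]
  refine Finset.prod_congr rfl fun i _ => ?_
  rw [show s i * (G.target (q i) - f (fun j => (q j).1.1) i - g (fun j => (q j).1.2.1) i -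
      h (fun j => (q j).1.2.2) i) = s i * G.target (q i) + (-(s i * h (fun j => (q j).1.2.2) i)
        + -(s i * g (fun j => (q j).1.2.1) i) + -(s i * f (fun j => (q j).1.1) i)) by ring]
  simp only [AddChar.map_add_eq_mul, Circle.coe_mul]
  push_cast
  ring

end XORGame

theorem mainTheorem3 {X Y Z : Type*} [Fintype X] [Fintype Y] [Fintype Z] (m : ℕ) [NeZero m]
    (G : XORGame X Y Z (ZMod m)) (hconn : PairwiseConnected G.dist)
    (hT : Nonembeddable G.dist G.phase) :
    ∃ c : ℝ, 0 < c ∧ ∀ n : ℕ, G.repeatedValue n ≤ (2 : ℝ) ^ (-(c * n)) := by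
  obtain ⟨ρ, hρ0, hρ1, hb⟩ := G.decayBound_freq hconn hT
  have hs0 : 0 < max ρ (1 / 2) := lt_max_of_lt_right (by norm_num)
  have hs1 : max ρ (1 / 2) < 1 := max_lt hρ1 (by norm_num)
  refine ⟨-Real.logb 2 (max ρ (1 / 2)), neg_pos.2 (Real.logb_neg (by norm_num) hs0 hs1),
    fun n => ?_⟩
  have hpow : (2 : ℝ) ^ (-(-Real.logb 2 (max ρ (1 / 2)) * n)) = max ρ (1 / 2) ^ n := by
    rw [neg_mul, neg_neg, Real.rpow_mul (by norm_num), Real.rpow_logb (by norm_num) (by norm_num)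
      hs0, Real.rpow_natCast]
  rw [hpow]
  refine ciSup_le fun ⟨f, g, h⟩ => ?_
  have hcorr := hb (Fin n) (fun i : Bool ⊕ Unit => match i with
      | .inl false => G.freqFun (fun p => p.1.2.1) g
      | .inl true => G.freqFun (fun p => p.1.2.2) h
      | .inr _ => G.freqFun (fun p => p.1.1) f) ⟨?_, ?_⟩
  · rw [← G.winProb_eq_corr, Complex.norm_real, Fintype.card_fin] at hcorr
    exact (le_abs_self _).trans (hcorr.trans (pow_le_pow_left₀ hρ0 (le_max_left _ _) n))
  · rintro ((_ | _) | i) q <;> exact G.norm_freqFun_le _ _ _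
  · rintro ((_ | _) | i) q q' hq <;> exact G.freqFun_congr _ _ _ _ hq
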